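/- Let $G=(V,E)$ be a finite directed graph with $n=|V|\ge 1$ nodes and $m=|E|$ edges. In the triggering model every node $v$ independently draws a random triggering set $T(v)$ of in-neighbours of $v$ from a given distribution; the live-edge graph has the edges $(u,v)$ with $u\in T(v)$, and the influence spread $\sigma(S)$ is the expected number of nodes reachable from $S$ in it. The SNI centrality of $v$ is $\psi_v=\sigma(\{v\})$, and $\psi^{(k)}$ is the $k$-th largest of the values $(\psi_v)_{v\in V}$. A random RR set $R$ is generated as follows: choose a root in $V$ uniformly at random and start with $R=\{\text{root}\}$; as long as some $u\in R$ has no triggering set yet, draw $T(u)$ and add its elements to $R$. Algorithm ASNI-RR with parameters $\varepsilon>0$, $\ell>0$, $k\in\{1,\dots,n\}$ works as follows. Put $\varepsilon'=\sqrt2\,\varepsilon$, $\theta_0=0$, $LB=1$ and $est_v=0$ for all $v\in V$. Phase 1: for $i=1,\dots,\lfloor\log_2 n\rfloor-1$, put $x=n/2^i$ and $$\theta_i=\left\lceil \frac{n\left((\ell+1)\ln n+\ln\log_2 n+\ln 2\right)\left(2+\tfrac23\varepsilon'\right)}{\varepsilon'^2x}\right\rceil ,$$ generate $\theta_i-\theta_{i-1}$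 fresh random RR sets, adding $1$ to $est_u$ for every node $u$ of each of them, and let $est^{(k)}$ be the $k$-th largest estimate; if $n\,est^{(k)}/\theta_i\ge(1+\varepsilon')x$, set $LB=n\,est^{(k)}/(\theta_i(1+\varepsilon'))$ and leave the loop. Phase 2: put $$\theta=\left\lceil \frac{n\left((\ell+1)\ln n+\ln 4\right)\left(2+\tfrac23\varepsilon\right)}{\varepsilon^2\,LB}\right\rceil ,$$ reset all $est_v$ to $0$, generate $\theta$ fresh random RR sets, again adding $1$ to $est_u$ for every node $u$ of each of them, and return $\hat\psi_v=n\,est_v/\theta$ for all $v\in V$. For all $\varepsilon>0$, $\ell>0$ and $k\in\{1,\dots,n\}$ the returned estimates satisfy: (a) (unbiasedness) $\mathbb E[\hat\psi_v]=\psi_v$ for all $v\in V$; (b) (robustness) with probability at least $1-n^{-\ell}$, $|\hat\psi_v-\psi_v|\le\varepsilon\psi_v$ for all $v\in V$ with $\psi_v>\psi^{(k)}$, and $|\hat\psi_v-\psi_v|\le\varepsilon\psi^{(k)}$ for all $v\in V$ with $\psi_v\le\psi^{(k)}$. (c) (expected running time) Count the steps spent on generating the RR sets and on increasing the estimates: one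 step for each choice of a root, for each node of $R$ that is picked for a draw, for each element of a drawn triggering set, and for each increase of an estimate, plus the time of drawing the triggering sets, where a draw of $T(u)$ takes at most $c$ times the in-degree of $u$. For all constants $c\ge0$, $\ell_0>0$ and $\varepsilon_0>0$ there is a constant $C$, depending only on these, such that whenever $n\ge2$, $m\ge1$, $0<\varepsilon\le\varepsilon_0$, $\ell\ge\ell_0$, $1\le k\le n$ and $\ell\ge(\log_2k-\log_2\log_2n)/\log_2n$, the expected number of steps of ASNI-RR is at most $$C\cdot\frac{\ell\,(m+n)\,\log n\cdot\mathbb E[\sigma(\{\tilde v\})]}{\psi^{(k)}\,\varepsilon^2},$$ where $\tilde v$ is a random node drawn from $V$ with probability proportional to its in-degree. -/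

import Mathlib

open scoped ENNReal

noncomputable section

/-- An instance of the triggering model on the finite vertex set `V`: a directed graph, where
`(u, v) ∈ edges` is an edge from `u` to `v`, and for every node `v` a probability distribution
of its triggering set, which is a random set of in-neighbours of `v`. -/
structure TriggeringInstance (V : Type*) where
  edges : Finset (V × V)
  trig : V → PMF (Finset V)
  trig_subset : ∀ v, ∀ T ∈ (trig v).support, ∀ u ∈ T, (u, v) ∈ edges

/-- The `k`-th largest value (counted with multiplicity, `1 ≤ k ≤ |V|`) of the family `f`. -/
def kthLargest {V α : Type*} [Fintype V] [LinearOrder α] [Zero α] (f : V → α) (k : ℕ) : α :=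
  ((Finset.univ.val.map f).sort (· ≥ ·)).getD (k - 1) 0

namespace TriggeringInstance

variable {V : Type*} [Fintype V] [DecidableEq V]

/-- The in-degree of `v`. -/
def inDegree (I : TriggeringInstance V) (v : V) : ℕ :=
  (I.edges.filter (fun e => e.2 = v)).card

/-- The probability that the independently drawn triggering sets are `L v`, for all `v`; the
family `L` encodes the live-edge graph whose edges are the pairs `(u, v)` with `u ∈ L v`. -/
def liveProb (I : TriggeringInstance V) (L : V → Finset V) : ℝ :=
  ∏ v, (I.trig v (L v)).toReal

open Classical in
/-- The nodes reachable from `S` in the live-edge graph `L`. -/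
def reach (L : V → Finset V) (S : Finset V) : Finset V :=
  Finset.univ.filter (fun v => ∃ s ∈ S, Relation.ReflTransGen (fun a b => a ∈ L b) s v)

/-- The influence spread `σ(S)`: the expected number of nodes activated by the seed set `S`. -/
def spread (I : TriggeringInstance V) (S : Finset V) : ℝ :=
  ∑ L : V → Finset V, I.liveProb L * ((reach L S).card : ℝ)

/-- Single-node-influence centrality. -/
def sni (I : TriggeringInstance V) (v : V) : ℝ := I.spread {v}

/-- `𝔼[σ(ṽ)]`, for a random node `ṽ` drawn with probability proportional to its in-degree
(meaningful when the graph has an edge). -/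
def meanSpread (I : TriggeringInstance V) : ℝ :=
  ∑ v, ((I.inDegree v : ℝ) / (I.edges.card : ℝ)) * I.spread {v}

/-- The reversed diffusion process. `R` is the current set and `D` is the set of nodes that
already have a triggering set. As long as some node of `R` has none, draw one for such a node and
add it to `R`. The process returns the final set and the number of steps: for a node `u` with
drawn set `T` we charge `drawTime u` for the draw, `|T|` for adding `T`, and `1` for picking `u`. -/
def growRR {V : Type*} [Fintype V] [DecidableEq V] (I : TriggeringInstance V)
    (drawTime : V → ℕ) (R D : Finset V) :
    PMF (Finset V × ℕ) :=
  if h : (R \ D).Nonempty then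
    (I.trig h.choose).bind fun T =>
      (growRR I drawTime (R ∪ T) (insert h.choose D)).bind fun o =>
        PMF.pure (o.1, o.2 + (drawTime h.choose + T.card + 1))
  else PMF.pure (R, 0)
termination_by (Finset.univ \ D).card
decreasing_by
  have hu := Finset.mem_sdiff.mp h.choose_spec
  apply Finset.card_lt_card
  rw [Finset.ssubset_iff_of_subset
    (Finset.sdiff_subset_sdiff (Finset.Subset.refl _) (Finset.subset_insert _ _))]
  exact ⟨h.choose, by simp [hu.2], by simp⟩

/-- A random RR set with the number of steps spent on it: the root is uniform (one step). -/
def randomRR [Nonempty V] (I : TriggeringInstance V) (drawTime : V → ℕ) :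
    PMF (Finset V × ℕ) :=
  (PMF.uniformOfFintype V).bind fun v =>
    (I.growRR drawTime {v} ∅).bind fun o => PMF.pure (o.1, o.2 + 1)

/-- The inner loop: generate `t` fresh RR sets one after another and increase `est u` by `1` for
every node `u` of each of them (one step per increase). Returns the new estimates and the
number of steps. -/
def sampleLoop [Nonempty V] (I : TriggeringInstance V) (drawTime : V → ℕ) :
    ℕ → (V → ℕ) → PMF ((V → ℕ) × ℕ)
  | 0, est => PMF.pure (est, 0)
  | t + 1, est =>
    (I.randomRR drawTime).bind fun r =>
      (sampleLoop I drawTime t (fun u => if u ∈ r.1 then est u + 1 else est u)).bind fun o =>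
        PMF.pure (o.1, r.2 + r.1.card + o.2)

/-- `θ_i`, the number of RR sets generated by the end of round `i` of Phase 1, where
`ε' = √2 ε` and `x = n / 2 ^ i`; `θ_0 = 0`. -/
def roundSize (n : ℕ) (ε ℓ : ℝ) : ℕ → ℕ
  | 0 => 0
  | i + 1 =>
    ⌈((n : ℝ) * ((ℓ + 1) * Real.log n + Real.log (Real.logb 2 n) + Real.log 2)
        * (2 + 2 / 3 * (√2 * ε))) / ((√2 * ε) ^ 2 * ((n : ℝ) / 2 ^ (i + 1)))⌉₊

/-- Phase 1, started at round `i` with at most `r` rounds to go. Returns `LB` and the number of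
steps. -/
def phaseOne [Nonempty V] (I : TriggeringInstance V) (drawTime : V → ℕ) (ε ℓ : ℝ) (k : ℕ) :
    ℕ → ℕ → (V → ℕ) → PMF (ℝ × ℕ)
  | 0, _, _ => PMF.pure (1, 0)
  | r + 1, i, est =>
    let n := Fintype.card V
    let θ := roundSize n ε ℓ
    (I.sampleLoop drawTime (θ i - θ (i - 1)) est).bind fun o =>
      let K : ℝ := (kthLargest o.1 k : ℕ)
      if (1 + √2 * ε) * ((n : ℝ) / 2 ^ i) ≤ (n : ℝ) * K / (θ i : ℝ) then
        PMF.pure ((n : ℝ) * K / ((θ i : ℝ) * (1 + √2 * ε)), o.2)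
      else
        (phaseOne I drawTime ε ℓ k r (i + 1) o.1).bind fun q => PMF.pure (q.1, o.2 + q.2)

/-- `θ`, the number of RR sets generated in Phase 2. -/
def finalSize (n : ℕ) (ε ℓ LB : ℝ) : ℕ :=
  ⌈((n : ℝ) * ((ℓ + 1) * Real.log n + Real.log 4) * (2 + 2 / 3 * ε)) / (ε ^ 2 * LB)⌉₊

/-- Algorithm ASNI-RR, as the joint distribution of the returned estimates and of the number of
steps. The steps counted are those spent on generating the RR sets and on increasing the
estimates, in both phases. Phase 1 has rounds `i = 1, …, ⌊log₂ n⌋ - 1`. -/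
def asniRR [Nonempty V] (I : TriggeringInstance V) (drawTime : V → ℕ) (ε ℓ : ℝ) (k : ℕ) :
    PMF ((V → ℝ) × ℕ) :=
  let n := Fintype.card V
  (I.phaseOne drawTime ε ℓ k (Nat.log 2 n - 1) 1 (fun _ => 0)).bind fun p =>
    let θ := finalSize n ε ℓ p.1
    (I.sampleLoop drawTime θ (fun _ => 0)).bind fun o =>
      PMF.pure (fun v => (n : ℝ) * (o.1 v : ℝ) / (θ : ℝ), p.2 + o.2)

/-- The relative-error guarantee for the top `k` nodes, for the estimates `est`. -/
def Robust (I : TriggeringInstance V) (ε : ℝ) (k : ℕ) (est : V → ℝ) : Prop :=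
  ∀ v, (kthLargest I.sni k < I.sni v → |est v - I.sni v| ≤ ε * I.sni v) ∧
    (I.sni v ≤ kthLargest I.sni k → |est v - I.sni v| ≤ ε * kthLargest I.sni k)

end TriggeringInstance

end

/-! A reverse search that draws triggering sets on demand has the same law as one in a live-edge
graph drawn beforehand (deferred decisions, `expect_growRR`). Hence `v` lies in a random RR set with
probability `ψ_v / n` (`prob_mem_randomRR`), so each estimate is a binomial count. Phase 2 uses
fresh samples, and its size is fixed once `LB` is known; this gives unbiasedness.

Robustness rests on Bernstein-type tails for deviations `ε y` with any `y ≥ ψ_v / n`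
(`sampleLoop_upper_tail`, `sampleLoop_lower_tail`). A round of Phase 1 that returns `LB > ψ⁽ᵏ⁾`
makes some node with `ψ_v ≤ ψ⁽ᵏ⁾` grossly overestimated. A union bound over nodes and rounds gives
failure probability at most `1 / (2 n ^ ℓ)`; the stopping rule does no harm, since the estimates of
each round are compared with an unstopped run (`prob_phaseOne_gt_le`). If `LB ≤ ψ⁽ᵏ⁾`, then Phase 2
is large enough for a union bound over nodes and both tails, which costs the other `1 / (2 n ^ ℓ)`.

For the running time, a node of an RR set costs `O(indegree + 1)`, so an RR set costs `O((m + n)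
𝔼[σ(ṽ)] / n)` on average (`rrCost_le`). It remains to bound the expected number of RR sets. Some
round has a threshold within a constant factor of `ψ⁽ᵏ⁾` but below `ψ⁽ᵏ⁾ / (1 + ε') ^ 2`, unless
`ψ⁽ᵏ⁾` itself is bounded by a constant (`exists_round_or_le`). That round fails to stop only if one
of the top `k` nodes is underestimated, which has probability at most `1 / (2 n)` by the assumption
relating `k` and `ℓ` (`prob_notStopped_le`). The worst-case size, that for threshold `1`, exceeds
the one for threshold `n` by a factor of at most `n`, so this failure is harmless. -/

set_option linter.unusedSectionVars false

/-! ### Expectations and probabilities with values in `ℝ≥0∞` -/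

namespace PMF

variable {α β : Type*}

/-- The expectation of an `ℝ≥0∞`-valued function. -/
noncomputable def expect (μ : PMF α) (f : α → ℝ≥0∞) : ℝ≥0∞ := ∑' a, μ a * f a

/-- The probability of a set, as the expectation of its indicator. -/
noncomputable def prob (μ : PMF α) (s : Set α) : ℝ≥0∞ := μ.expect (s.indicator 1)

theorem expect_pure (a : α) (f : α → ℝ≥0∞) : (PMF.pure a).expect f = f a := by
  unfold expect
  rw [tsum_eq_single a]
  · simp
  · intro b hb
    simp [PMF.pure_apply, hb]

theorem expect_bind (μ : PMF α) (κ : α → PMF β) (f : β → ℝ≥0∞) :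
    (μ.bind κ).expect f = μ.expect fun a => (κ a).expect f := by
  unfold expect
  simp_rw [PMF.bind_apply, ← ENNReal.tsum_mul_right, ← ENNReal.tsum_mul_left]
  rw [ENNReal.tsum_comm]
  simp_rw [mul_assoc]

theorem expect_mono_support (μ : PMF α) {f g : α → ℝ≥0∞} (h : ∀ a ∈ μ.support, f a ≤ g a) :
    μ.expect f ≤ μ.expect g := by
  refine ENNReal.tsum_le_tsum fun a => ?_
  by_cases ha : μ a = 0
  · simp [ha]
  · gcongr
    exact h a ((μ.mem_support_iff a).2 ha)

theorem expect_mono (μ : PMF α) {f g : α → ℝ≥0∞} (h : ∀ a, f a ≤ g a) :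
    μ.expect f ≤ μ.expect g := μ.expect_mono_support fun a _ => h a

theorem expect_congr_support (μ : PMF α) {f g : α → ℝ≥0∞} (h : ∀ a ∈ μ.support, f a = g a) :
    μ.expect f = μ.expect g :=
  le_antisymm (μ.expect_mono_support fun a ha => (h a ha).le)
    (μ.expect_mono_support fun a ha => (h a ha).ge)

theorem expect_add (μ : PMF α) (f g : α → ℝ≥0∞) :
    (μ.expect fun a => f a + g a) = μ.expect f + μ.expect g := by
  simp [expect, mul_add, ENNReal.tsum_add]

theorem expect_const_mul (μ : PMF α) (c : ℝ≥0∞) (f : α → ℝ≥0∞) :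
    (μ.expect fun a => c * f a) = c * μ.expect f := by
  simp only [expect, ← ENNReal.tsum_mul_left]
  exact tsum_congr fun a => by ring

theorem expect_mul_const (μ : PMF α) (c : ℝ≥0∞) (f : α → ℝ≥0∞) :
    (μ.expect fun a => f a * c) = μ.expect f * c := by
  simp_rw [mul_comm _ c]
  exact μ.expect_const_mul c f

theorem expect_const (μ : PMF α) (c : ℝ≥0∞) : (μ.expect fun _ => c) = c := by
  simp [expect, ENNReal.tsum_mul_right, μ.tsum_coe]

theorem expect_sum {ι : Type*} (μ : PMF α) (s : Finset ι) (f : ι → α → ℝ≥0∞) :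
    (μ.expect fun a => ∑ i ∈ s, f i a) = ∑ i ∈ s, μ.expect (f i) := by
  classical
  induction s using Finset.induction_on with
  | empty => simp [expect]
  | insert i s hi ih => simp only [Finset.sum_insert hi, expect_add, ih]

theorem expect_fintype [Fintype α] (μ : PMF α) (f : α → ℝ≥0∞) :
    μ.expect f = ∑ a, μ a * f a := tsum_fintype _

theorem prob_eq_toOuterMeasure (μ : PMF α) (s : Set α) : μ.prob s = μ.toOuterMeasure s := by
  rw [PMF.toOuterMeasure_apply]
  refine tsum_congr fun a => ?_
  by_cases h : a ∈ s <;> simp [h]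

theorem prob_mono_support (μ : PMF α) {s t : Set α} (h : ∀ a ∈ μ.support, a ∈ s → a ∈ t) :
    μ.prob s ≤ μ.prob t := by
  refine μ.expect_mono_support fun a ha => ?_
  by_cases hs : a ∈ s
  · simp [hs, h a ha hs]
  · simp [hs]

theorem prob_mono (μ : PMF α) {s t : Set α} (h : s ⊆ t) : μ.prob s ≤ μ.prob t :=
  μ.prob_mono_support fun _ _ hs => h hs

theorem prob_le_one (μ : PMF α) (s : Set α) : μ.prob s ≤ 1 := by
  calc μ.prob s ≤ μ.expect fun _ => 1 := μ.expect_mono fun a => by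
        by_cases h : a ∈ s <;> simp [h]
    _ = 1 := μ.expect_const 1

theorem prob_add_prob_compl (μ : PMF α) (s : Set α) : μ.prob s + μ.prob sᶜ = 1 := by
  unfold prob
  rw [← expect_add, ← μ.expect_const 1]
  congr 1
  ext a
  by_cases h : a ∈ s <;> simp [h]

theorem prob_biUnion_le {ι : Type*} (μ : PMF α) (t : Finset ι) (s : ι → Set α) :
    μ.prob (⋃ i ∈ t, s i) ≤ ∑ i ∈ t, μ.prob (s i) := by
  unfold prob
  rw [← expect_sum]
  refine μ.expect_mono fun a => ?_
  by_cases h : a ∈ ⋃ i ∈ t, s i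
  · obtain ⟨i, hi, ha⟩ := Set.mem_iUnion₂.1 h
    rw [Set.indicator_of_mem h]
    calc (1 : ℝ≥0∞) = (s i).indicator 1 a := by simp [ha]
      _ ≤ _ := Finset.single_le_sum (f := fun i => (s i).indicator (1 : α → ℝ≥0∞) a)
        (fun _ _ => zero_le) hi
  · simp [h]

theorem prob_union_le (μ : PMF α) (s t : Set α) : μ.prob (s ∪ t) ≤ μ.prob s + μ.prob t := by
  unfold prob
  rw [← expect_add]
  refine μ.expect_mono fun a => ?_
  by_cases hs : a ∈ s <;> by_cases ht : a ∈ t <;> simp [hs, ht]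

theorem prob_le_expect (μ : PMF α) {s : Set α} {f : α → ℝ≥0∞} (h : ∀ a ∈ s, 1 ≤ f a) :
    μ.prob s ≤ μ.expect f := by
  refine μ.expect_mono fun a => ?_
  by_cases hs : a ∈ s
  · simpa [hs] using h a hs
  · simp [hs]

theorem prob_bind (μ : PMF α) (κ : α → PMF β) (s : Set β) :
    (μ.bind κ).prob s = μ.expect fun a => (κ a).prob s := μ.expect_bind κ _

theorem prob_pure (a : α) (s : Set α) : (PMF.pure a).prob s = s.indicator 1 a :=
  expect_pure a _

end PMF

/-! ### Order statistics through `k`-element sets -/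

/-- This form compares the order statistics of two families: a `k`-set on which one family is at
least its `k`-th largest value contains a node where the other is at most its own. -/
theorem kthLargest_spec {V α : Type*} [Fintype V] [LinearOrder α] [Zero α] (f : V → α) {k : ℕ}
    (hk : 1 ≤ k) (hkn : k ≤ Fintype.card V) :
    (∃ S : Finset V, S.card = k ∧ ∀ v ∈ S, kthLargest f k ≤ f v) ∧
    ∀ S : Finset V, S.card = k → ∃ v ∈ S, f v ≤ kthLargest f k := by
  classical
  -- Sorting acts on the values only; the permutation is pulled back to an enumeration `l` of the
  -- nodes themselves.
  obtain ⟨l, hl, hlu⟩ : ∃ l : List V, l.map f = (Finset.univ.val.map f).sort (· ≥ ·) ∧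
      (l : Multiset V) = Finset.univ.val := by
    have h1 : ((Finset.univ.val.map f).sort (· ≥ ·)).Perm (Finset.univ.toList.map f) := by
      rw [← Multiset.coe_eq_coe, Multiset.sort_eq, ← Multiset.map_coe, Finset.coe_toList]
    have h2 : Relation.Comp List.Perm (List.Forall₂ fun (b : α) (a : V) => b = f a)
        ((Finset.univ.val.map f).sort (· ≥ ·)) Finset.univ.toList := by
      refine ⟨_, h1, ?_⟩
      generalize (Finset.univ : Finset V).toList = l
      induction l with
      | nil => simp
      | cons a l ih => exact List.Forall₂.cons rfl ih
    obtain ⟨l, hl1, hl2⟩ := (List.perm_comp_forall₂ h2.choose_spec.1 h2.choose_spec.2)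
    refine ⟨l, ?_, ?_⟩
    · clear h1 h2 hl2
      generalize (Finset.univ.val.map f).sort (· ≥ ·) = m at hl1
      induction hl1 with
      | nil => rfl
      | cons h _ ih => simp [h, ih]
    · rw [← Finset.coe_toList, Multiset.coe_eq_coe]
      exact hl2
  have hlen : l.length = Fintype.card V := by
    rw [← Multiset.coe_card, hlu]; rfl
  have hnd : l.Nodup := by
    rw [← Multiset.coe_nodup, hlu]; exact Finset.univ.nodup
  have hs : (l.map f).Pairwise (· ≥ ·) := by rw [hl]; exact Multiset.pairwise_sort _ _
  have hk' : k - 1 < l.length := by omega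
  have hkth : kthLargest f k = f l[k - 1] := by
    rw [kthLargest, ← hl, List.getD_eq_getElem _ _ (by simpa using hk'), List.getElem_map]
  have hmono : ∀ i j (hi : i < l.length) (hj : j < l.length), i ≤ j → f l[j] ≤ f l[i] := by
    intro i j hi hj hij
    rcases hij.eq_or_lt with rfl | h
    · exact le_rfl
    · have := List.pairwise_iff_getElem.1 hs i j (by simpa) (by simpa) h
      simpa using this
  refine ⟨⟨(l.take k).toFinset, ?_, ?_⟩, ?_⟩
  · rw [List.toFinset_card_of_nodup (hnd.sublist (List.take_sublist _ _)), List.length_take]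
    omega
  · intro v hv
    rw [List.mem_toFinset, List.mem_iff_getElem] at hv
    obtain ⟨i, hi, rfl⟩ := hv
    rw [List.length_take] at hi
    rw [hkth, List.getElem_take]
    exact hmono _ _ _ _ (by omega)
  · intro S hS
    by_contra! hcon
    -- Nodes whose value exceeds the entry at index `k - 1` occupy earlier positions, and there are
    -- only `k - 1` of these.
    have hsub : S ⊆ (l.take (k - 1)).toFinset := by
      intro v hv
      have hvl : v ∈ l := by
        rw [← Multiset.mem_coe, hlu]; exact Finset.mem_univ v
      obtain ⟨i, hi, rfl⟩ := List.mem_iff_getElem.1 hvl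
      have h := hcon _ hv
      rw [hkth] at h
      have hik : i < k - 1 := by
        by_contra! hle
        exact absurd (hmono _ _ hk' hi hle) (not_le.2 h)
      rw [List.mem_toFinset, List.mem_iff_getElem]
      exact ⟨i, by rw [List.length_take]; omega, by simp⟩
    have h1 := Finset.card_le_card hsub
    have h2 := List.toFinset_card_le (l.take (k - 1))
    rw [List.length_take] at h2
    omega

/-! ### RR sets and live-edge graphs: deferred decisions -/

noncomputable section

namespace TriggeringInstance

variable {V : Type*} [Fintype V] [DecidableEq V]

/-- The probability of the family `L` of triggering sets, as an extended nonnegative real. -/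
def liveWeight (I : TriggeringInstance V) (L : V → Finset V) : ℝ≥0∞ := ∏ v, I.trig v (L v)

theorem liveProb_eq (I : TriggeringInstance V) (L : V → Finset V) :
    I.liveProb L = (I.liveWeight L).toReal := by
  simp [liveProb, liveWeight, ENNReal.toReal_prod]

theorem liveWeight_ne_top (I : TriggeringInstance V) (L : V → Finset V) :
    I.liveWeight L ≠ ∞ :=
  ENNReal.prod_ne_top fun _ _ => PMF.apply_ne_top _ _

theorem sum_liveWeight (I : TriggeringInstance V) : ∑ L, I.liveWeight L = 1 := by
  unfold liveWeight
  rw [← Fintype.piFinset_univ, ← Finset.prod_univ_sum (fun _ => Finset.univ)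
    (fun v T => I.trig v T)]
  refine Finset.prod_eq_one fun v _ => ?_
  rw [← (I.trig v).tsum_coe, tsum_fintype]

/-- Exchanging `T` with `L u` permutes the factors. The product form avoids dividing by `I.trig u (L
u)`, which may vanish. -/
theorem liveWeight_update (I : TriggeringInstance V) (L : V → Finset V) (u : V) (T : Finset V) :
    I.trig u (L u) * I.liveWeight (Function.update L u T) = I.trig u T * I.liveWeight L := by
  have h : ∀ M : V → Finset V, I.liveWeight M
      = I.trig u (M u) * ∏ v ∈ Finset.univ.erase u, I.trig v (M v) := fun M =>
    (Finset.mul_prod_erase Finset.univ (fun v => I.trig v (M v)) (Finset.mem_univ u)).symm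
  rw [h, h L]
  have h2 : ∏ v ∈ Finset.univ.erase u, I.trig v (Function.update L u T v)
      = ∏ v ∈ Finset.univ.erase u, I.trig v (L v) :=
    Finset.prod_congr rfl fun v hv => by
      rw [Function.update_of_ne (Finset.ne_of_mem_erase hv)]
  rw [h2, Function.update_self]
  ring

/-- Redrawing one of the independent triggering sets does not change their distribution. -/
theorem sum_liveWeight_resample (I : TriggeringInstance V) (u : V)
    (F : (V → Finset V) → ℝ≥0∞) :
    ∑ L, I.liveWeight L * F L
      = ∑ T, I.trig u T * ∑ L, I.liveWeight L * F (Function.update L u T) := by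
  -- Swapping the fresh draw with the old one is an involution that preserves the joint weight.
  let e : Finset V × (V → Finset V) → Finset V × (V → Finset V) :=
    fun p => (p.2 u, Function.update p.2 u p.1)
  have he : Function.Involutive e := by
    rintro ⟨T, L⟩
    simp [e]
  have h1 : ∑ T, I.trig u T * ∑ L, I.liveWeight L * F (Function.update L u T)
      = ∑ p : Finset V × (V → Finset V),
        I.trig u p.1 * (I.liveWeight p.2 * F (Function.update p.2 u p.1)) := by
    rw [Fintype.sum_prod_type]
    simp_rw [Finset.mul_sum]
  have h2 : ∑ L, I.liveWeight L * F L
      = ∑ p : Finset V × (V → Finset V), I.trig u p.1 * (I.liveWeight p.2 * F p.2) := by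
    rw [Fintype.sum_prod_type]
    simp_rw [← Finset.mul_sum, ← Finset.sum_mul]
    rw [show ∑ T, I.trig u T = 1 by rw [← (I.trig u).tsum_coe, tsum_fintype], one_mul]
  rw [h1, h2, ← Equiv.sum_comp he.toPerm]
  refine Finset.sum_congr rfl fun p _ => ?_
  simp only [Function.Involutive.coe_toPerm, e]
  rw [← mul_assoc, ← mul_assoc, liveWeight_update]

open Classical in
/-- The nodes found by a reverse search from `R` in the live-edge graph `L` that only expands
nodes outside `D`. -/
def reverseReach (L : V → Finset V) (D R : Finset V) : Finset V :=
  Finset.univ.filter fun w => ∃ r ∈ R, Relation.ReflTransGen (fun a b => a ∉ D ∧ b ∈ L a) r w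

theorem mem_reverseReach {L : V → Finset V} {D R : Finset V} {w : V} :
    w ∈ reverseReach L D R ↔
      ∃ r ∈ R, Relation.ReflTransGen (fun a b => a ∉ D ∧ b ∈ L a) r w := by
  simp [reverseReach]

theorem reverseReach_of_subset {L : V → Finset V} {D R : Finset V} (h : R ⊆ D) :
    reverseReach L D R = R := by
  ext w
  rw [mem_reverseReach]
  constructor
  · rintro ⟨r, hr, hrw⟩
    rcases hrw.cases_head with rfl | ⟨c, hc, _⟩
    · exact hr
    · exact absurd (h hr) hc.1
  · exact fun hw => ⟨w, hw, .refl⟩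

/-- The triggering set of an expanded node is never read again, so redrawing it is harmless. -/
theorem reverseReach_update {L : V → Finset V} {D R : Finset V} {u : V} (hu : u ∈ D)
    (T : Finset V) : reverseReach (Function.update L u T) D R = reverseReach L D R := by
  have h : (fun a b => a ∉ D ∧ b ∈ Function.update L u T a) = fun a b => a ∉ D ∧ b ∈ L a := by
    ext a b
    by_cases ha : a = u
    · subst ha; simp [hu]
    · rw [Function.update_of_ne ha]
  ext w
  rw [mem_reverseReach, mem_reverseReach, h]

/-- One expansion of `u` suffices: a path that visits `u` can be cut after its last visit and
restarted in `L u`. -/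
theorem reverseReach_expand {L : V → Finset V} {D R : Finset V} {u : V} (hu : u ∈ R)
    (huD : u ∉ D) : reverseReach L D R = reverseReach L (insert u D) (R ∪ L u) := by
  ext w
  rw [mem_reverseReach, mem_reverseReach]
  constructor
  · rintro ⟨r, hr, hrw⟩
    induction hrw with
    | refl => exact ⟨r, Finset.mem_union_left _ hr, .refl⟩
    | @tail b c _ hbc ih =>
      obtain ⟨s, hs, hsb⟩ := ih
      by_cases hb : b = u
      · subst hb
        exact ⟨c, Finset.mem_union_right _ hbc.2, .refl⟩
      · exact ⟨s, hs, hsb.tail ⟨by simp [hb, hbc.1], hbc.2⟩⟩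
  · rintro ⟨r, hr, hrw⟩
    have hrw' : Relation.ReflTransGen (fun a b => a ∉ D ∧ b ∈ L a) r w :=
      Relation.ReflTransGen.mono
        (fun a b hab => ⟨fun ha => hab.1 (Finset.mem_insert_of_mem ha), hab.2⟩) _ _ hrw
    rcases Finset.mem_union.1 hr with hr | hr
    · exact ⟨r, hr, hrw'⟩
    · exact ⟨u, hu, hrw'.head ⟨huD, hr⟩⟩

theorem mem_reverseReach_empty {L : V → Finset V} {r w : V} :
    w ∈ reverseReach L ∅ {r} ↔ r ∈ reach L {w} := by
  have h := Relation.reflTransGen_swap (r := fun a b => b ∈ L a) (a := w) (b := r)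
  simp only [mem_reverseReach, reach, Finset.mem_filter, Finset.mem_univ, Finset.mem_singleton,
    exists_eq_left, Finset.notMem_empty, not_false_eq_true, true_and]
  exact h.symm

/-- The reverse search that draws triggering sets when they are needed finds the same random set
as the one that draws all of them beforehand. -/
theorem expect_growRR (I : TriggeringInstance V) (drawTime : V → ℕ) (f : Finset V → ℝ≥0∞)
    (R D : Finset V) :
    ((I.growRR drawTime R D).expect fun o => f o.1)
      = ∑ L, I.liveWeight L * f (reverseReach L D R) := by
  induction hm : (Finset.univ \ D).card using Nat.strong_induction_on generalizing R D with
  | _ m ih =>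
  rw [growRR]
  split_ifs with h
  · have hu := Finset.mem_sdiff.mp h.choose_spec
    set u := h.choose
    have hlt : (Finset.univ \ insert u D).card < m := by
      rw [← hm]
      apply Finset.card_lt_card
      rw [Finset.ssubset_iff_of_subset
        (Finset.sdiff_subset_sdiff (Finset.Subset.refl _) (Finset.subset_insert _ _))]
      exact ⟨u, by simp [hu.2], by simp⟩
    -- The set drawn by the process takes the place of the coordinate `L u`.
    rw [PMF.expect_bind, PMF.expect_fintype, sum_liveWeight_resample I u]
    refine Finset.sum_congr rfl fun T _ => ?_
    congr 1
    rw [PMF.expect_bind]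
    simp only [PMF.expect_pure]
    rw [ih _ hlt _ _ rfl]
    refine Finset.sum_congr rfl fun L _ => ?_
    rw [reverseReach_expand hu.1 hu.2, Function.update_self,
      reverseReach_update (Finset.mem_insert_self _ _)]
  · rw [PMF.expect_pure]
    have hRD : R ⊆ D := by
      rwa [Finset.not_nonempty_iff_eq_empty, Finset.sdiff_eq_empty_iff_subset] at h
    simp_rw [reverseReach_of_subset hRD]
    rw [← Finset.sum_mul, sum_liveWeight, one_mul]

theorem card_le_inDegree (I : TriggeringInstance V) {v : V} {T : Finset V}
    (hT : T ∈ (I.trig v).support) : T.card ≤ I.inDegree v := by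
  rw [← Finset.card_map (⟨fun u => (u, v), fun a b h => (Prod.ext_iff.1 h).1⟩ : V ↪ V × V)]
  refine Finset.card_le_card fun e he => ?_
  obtain ⟨u, hu, rfl⟩ := Finset.mem_map.1 he
  exact Finset.mem_filter.2 ⟨I.trig_subset v T hT u hu, rfl⟩

/-- Each node of the final set outside `D` is expanded exactly once, and its drawn set has at most
in-degree many elements. The size bound later absorbs the unit charges per node into in-degrees. -/
theorem growRR_support (I : TriggeringInstance V) {drawTime : V → ℕ} {c : ℕ}
    (hc : ∀ v, drawTime v ≤ c * I.inDegree v) (R D : Finset V) :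
    ∀ o ∈ (I.growRR drawTime R D).support, R ⊆ o.1 ∧
      o.2 ≤ ∑ u ∈ o.1 \ D, ((c + 1) * I.inDegree u + 1) ∧
      o.1.card ≤ R.card + ∑ u ∈ o.1 \ D, I.inDegree u := by
  induction hm : (Finset.univ \ D).card using Nat.strong_induction_on generalizing R D with
  | _ m ih =>
  rw [growRR]
  split_ifs with h
  · have hu := Finset.mem_sdiff.mp h.choose_spec
    set u := h.choose
    have hlt : (Finset.univ \ insert u D).card < m := by
      rw [← hm]
      apply Finset.card_lt_card
      rw [Finset.ssubset_iff_of_subset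
        (Finset.sdiff_subset_sdiff (Finset.Subset.refl _) (Finset.subset_insert _ _))]
      exact ⟨u, by simp [hu.2], by simp⟩
    intro o ho
    simp only [PMF.mem_support_bind_iff, PMF.support_pure, Set.mem_singleton_iff] at ho
    obtain ⟨T, hT, o', ho', rfl⟩ := ho
    obtain ⟨h1, h2, h3⟩ := ih _ hlt _ _ rfl o' ho'
    have hRo : R ⊆ o'.1 := Finset.union_subset_left h1
    have hins : o'.1 \ D = insert u (o'.1 \ insert u D) := by
      ext w
      by_cases hw : w = u
      · subst hw; simp [hRo hu.1, hu.2]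
      · simp [hw]
    have hnot : u ∉ o'.1 \ insert u D := by simp
    have hTd := I.card_le_inDegree hT
    have hcu := hc u
    have hcard := Finset.card_union_le R T
    refine ⟨hRo, ?_, ?_⟩
    · simp only [hins, Finset.sum_insert hnot]
      linarith
    · simp only [hins, Finset.sum_insert hnot]
      linarith
  · intro o ho
    rw [PMF.support_pure, Set.mem_singleton_iff] at ho
    subst ho
    simp

section

variable [Nonempty V]

theorem expect_randomRR (I : TriggeringInstance V) (drawTime : V → ℕ) (f : Finset V → ℝ≥0∞) :
    ((I.randomRR drawTime).expect fun o => f o.1)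
      = ∑ L, I.liveWeight L * ((∑ r, f (reverseReach L ∅ {r})) / Fintype.card V) := by
  rw [randomRR, PMF.expect_bind, PMF.expect_fintype]
  simp_rw [PMF.expect_bind, PMF.expect_pure, expect_growRR, PMF.uniformOfFintype_apply,
    Finset.mul_sum]
  rw [Finset.sum_comm]
  refine Finset.sum_congr rfl fun L _ => ?_
  rw [ENNReal.div_eq_inv_mul, Finset.mul_sum, Finset.mul_sum]
  exact Finset.sum_congr rfl fun r _ => by ring

/-- The centrality of `v` is `n` times the probability that `v` lies in a random RR set. -/
theorem prob_mem_randomRR (I : TriggeringInstance V) (drawTime : V → ℕ) (v : V) :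
    (I.randomRR drawTime).prob {o | v ∈ o.1} = ENNReal.ofReal (I.sni v / Fintype.card V) := by
  classical
  have h0 : (I.randomRR drawTime).prob {o | v ∈ o.1}
      = (I.randomRR drawTime).expect fun o => if v ∈ o.1 then 1 else 0 := by
    refine congrArg (I.randomRR drawTime).expect (funext fun o => ?_)
    by_cases h : v ∈ o.1 <;> simp [h]
  rw [h0, I.expect_randomRR drawTime fun R => if v ∈ R then 1 else 0]
  have hL : ∀ L : V → Finset V,
      (∑ r, if v ∈ reverseReach L ∅ {r} then (1 : ℝ≥0∞) else 0) = ((reach L {v}).card : ℝ≥0∞) := by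
    intro L
    simp only [mem_reverseReach_empty]
    rw [Finset.sum_boole, Finset.filter_mem_eq_inter, Finset.univ_inter]
  simp only [hL]
  rw [sni, spread, Finset.sum_div, ENNReal.ofReal_sum_of_nonneg]
  · refine Finset.sum_congr rfl fun L _ => ?_
    rw [liveProb_eq, mul_div_assoc, ENNReal.ofReal_mul ENNReal.toReal_nonneg,
      ENNReal.ofReal_toReal (I.liveWeight_ne_top L), ENNReal.ofReal_div_of_pos
      (by exact_mod_cast Fintype.card_pos), ENNReal.ofReal_natCast, ENNReal.ofReal_natCast]
  · intro L _
    rw [liveProb_eq]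
    positivity

end

/-! ### Bounds on the centralities and the expected cost of one RR set -/

theorem sum_liveProb (I : TriggeringInstance V) : ∑ L, I.liveProb L = 1 := by
  simp_rw [liveProb_eq]
  rw [← ENNReal.toReal_sum fun L _ => I.liveWeight_ne_top L, sum_liveWeight, ENNReal.toReal_one]

theorem one_le_sni (I : TriggeringInstance V) (v : V) : 1 ≤ I.sni v := by
  rw [← I.sum_liveProb, sni, spread]
  refine Finset.sum_le_sum fun L _ => ?_
  refine le_mul_of_one_le_right (by rw [liveProb_eq]; positivity) ?_
  have : 0 < (reach L {v}).card :=
    Finset.card_pos.2 ⟨v, by simpa [reach] using Relation.ReflTransGen.refl⟩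
  exact_mod_cast this

theorem sni_le_card (I : TriggeringInstance V) (v : V) : I.sni v ≤ Fintype.card V := by
  rw [← one_mul (Fintype.card V : ℝ), ← I.sum_liveProb, Finset.sum_mul, sni, spread]
  refine Finset.sum_le_sum fun L _ => ?_
  have := Finset.card_le_univ (reach L {v})
  gcongr
  rw [liveProb_eq]; positivity

theorem sum_inDegree (I : TriggeringInstance V) : ∑ v, I.inDegree v = I.edges.card :=
  (Finset.card_eq_sum_card_fiberwise fun _ _ => Finset.mem_coe.2 (Finset.mem_univ _)).symm

theorem card_mul_meanSpread (I : TriggeringInstance V) (h : I.edges.Nonempty) :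
    I.edges.card * I.meanSpread = ∑ v, I.inDegree v * I.sni v := by
  have h0 : (I.edges.card : ℝ) ≠ 0 := by exact_mod_cast (Finset.card_pos.2 h).ne'
  rw [meanSpread, Finset.mul_sum]
  refine Finset.sum_congr rfl fun v _ => ?_
  rw [sni]
  field_simp

theorem one_le_meanSpread (I : TriggeringInstance V) (h : I.edges.Nonempty) :
    1 ≤ I.meanSpread := by
  have h0 : (0 : ℝ) < I.edges.card := by exact_mod_cast Finset.card_pos.2 h
  refine le_of_mul_le_mul_left ?_ h0
  rw [I.card_mul_meanSpread h, mul_one, ← I.sum_inDegree, Nat.cast_sum]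
  exact Finset.sum_le_sum fun v _ => le_mul_of_one_le_right (by positivity) (I.one_le_sni v)

/-- The expected number of steps spent on one random RR set and on counting its elements. -/
def rrCost [Nonempty V] (I : TriggeringInstance V) (drawTime : V → ℕ) : ℝ≥0∞ :=
  (I.randomRR drawTime).expect fun r => ((r.2 + r.1.card : ℕ) : ℝ≥0∞)

/-- With `s` the sum of in-degrees over the set, the steps are at most `1 + (c + 1) s + |R|`, and
counting adds `|R|` more; both copies of `|R|` are at most `1 + s`. -/
theorem randomRR_cost_le [Nonempty V] (I : TriggeringInstance V) {drawTime : V → ℕ} {c : ℕ}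
    (hc : ∀ v, drawTime v ≤ c * I.inDegree v) {r : Finset V × ℕ}
    (hr : r ∈ (I.randomRR drawTime).support) :
    r.2 + r.1.card ≤ 3 + (c + 3) * ∑ u ∈ r.1, I.inDegree u := by
  simp only [randomRR, PMF.mem_support_bind_iff, PMF.support_pure, Set.mem_singleton_iff] at hr
  obtain ⟨v, _, o, ho, rfl⟩ := hr
  obtain ⟨_, h2, h3⟩ := I.growRR_support hc _ _ o ho
  simp only [Finset.sdiff_empty, Finset.card_singleton, Finset.sum_add_distrib,
    ← Finset.mul_sum, Finset.sum_const, smul_eq_mul, mul_one] at h2 h3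
  linarith

/-- The expected in-degree sum over an RR set is `∑ indeg(u) ψ_u / n`, which is `m 𝔼[σ(ṽ)] / n`. The
additive `3` is absorbed because `𝔼[σ(ṽ)] ≥ 1`. -/
theorem rrCost_le [Nonempty V] (I : TriggeringInstance V) {drawTime : V → ℕ} {c : ℕ}
    (hc : ∀ v, drawTime v ≤ c * I.inDegree v) (h : I.edges.Nonempty) :
    I.rrCost drawTime ≤ ENNReal.ofReal
      ((c + 3) * ((I.edges.card + Fintype.card V) * I.meanSpread / Fintype.card V)) := by
  classical
  have hn : (0 : ℝ) < Fintype.card V := by exact_mod_cast Fintype.card_pos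
  have h1 : I.rrCost drawTime ≤ (I.randomRR drawTime).expect fun r =>
      3 + (c + 3) * ∑ u, (I.inDegree u : ℝ≥0∞) * ({o | u ∈ o.1} : Set _).indicator 1 r := by
    refine PMF.expect_mono_support _ fun r hr => ?_
    have h2 : ∑ u, (I.inDegree u : ℝ≥0∞) * ({o | u ∈ o.1} : Set (Finset V × ℕ)).indicator 1 r
        = ((∑ u ∈ r.1, I.inDegree u : ℕ) : ℝ≥0∞) := by
      rw [Nat.cast_sum, ← Finset.sum_subset (Finset.subset_univ r.1)]
      · exact Finset.sum_congr rfl fun u hu => by simp [hu]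
      · intro u _ hu
        simp [hu]
    rw [h2]
    exact_mod_cast I.randomRR_cost_le hc hr
  refine h1.trans ?_
  rw [PMF.expect_add, PMF.expect_const, PMF.expect_const_mul, PMF.expect_sum]
  simp_rw [PMF.expect_const_mul]
  change 3 + (c + 3) * ∑ u, (I.inDegree u : ℝ≥0∞) * (I.randomRR drawTime).prob {o | u ∈ o.1} ≤ _
  simp_rw [prob_mem_randomRR]
  have h3 : ∑ u, (I.inDegree u : ℝ≥0∞) * ENNReal.ofReal (I.sni u / Fintype.card V)
      = ENNReal.ofReal (I.edges.card * I.meanSpread / Fintype.card V) := by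
    rw [I.card_mul_meanSpread h, Finset.sum_div, ENNReal.ofReal_sum_of_nonneg]
    · refine Finset.sum_congr rfl fun u _ => ?_
      rw [mul_div_assoc, ENNReal.ofReal_mul (by positivity), ENNReal.ofReal_natCast]
    · intro u _
      have := I.one_le_sni u
      positivity
  have hM := I.one_le_meanSpread h
  rw [h3, show (3 : ℝ≥0∞) = ENNReal.ofReal 3 by simp,
    show (c : ℝ≥0∞) = ENNReal.ofReal c by simp,
    ← ENNReal.ofReal_add (by positivity) (by positivity),
    ← ENNReal.ofReal_mul (by positivity), ← ENNReal.ofReal_add (by positivity) (by positivity)]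
  refine ENNReal.ofReal_le_ofReal ?_
  have h4 : ((I.edges.card : ℝ) + Fintype.card V) * I.meanSpread / Fintype.card V
      = I.edges.card * I.meanSpread / Fintype.card V + I.meanSpread := by
    field_simp
  rw [h4]
  have hc0 : (0 : ℝ) ≤ c := by positivity
  nlinarith

end TriggeringInstance

end

/-! ### Moments and Bernstein-type tails of the estimates -/

noncomputable section

/-- `(1 - x + x²/2)(1 + x + x²/2) = 1 + x⁴/4 ≥ 1`. -/
theorem Real.exp_neg_le_quadratic {x : ℝ} (hx : 0 ≤ x) : Real.exp (-x) ≤ 1 - x + x ^ 2 / 2 := by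
  have h := Real.quadratic_le_exp_of_nonneg hx
  rw [Real.exp_neg, inv_le_iff_one_le_mul₀ (Real.exp_pos x)]
  have h1 : 0 ≤ 1 - x + x ^ 2 / 2 := by nlinarith [sq_nonneg (x - 1)]
  calc (1 : ℝ) ≤ (1 - x + x ^ 2 / 2) * (1 + x + x ^ 2 / 2) := by
        nlinarith [sq_nonneg (x ^ 2)]
    _ ≤ _ := by gcongr

/-- It dominates the exponential series from its quadratic term on by a geometric series of ratio `x
/ 3`. -/
theorem Nat.two_mul_three_pow_le_factorial (k : ℕ) : 2 * 3 ^ k ≤ (k + 2).factorial := by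
  induction k with
  | zero => simp
  | succ k ih =>
    rw [pow_succ, show k + 1 + 2 = (k + 2) + 1 by ring, Nat.factorial_succ]
    nlinarith

/-- The bound on the exponential series behind Bernstein's inequality. -/
theorem Real.exp_le_bernstein {x : ℝ} (hx : 0 ≤ x) (hx3 : x < 3) :
    Real.exp x ≤ 1 + x + x ^ 2 / (2 * (1 - x / 3)) := by
  have h1 : HasSum (fun k : ℕ => x ^ k / (k.factorial : ℝ)) (Real.exp x) := by
    rw [Real.exp_eq_exp_ℝ]
    exact NormedSpace.expSeries_div_hasSum_exp x
  have h2 := (hasSum_nat_add_iff' 2).2 h1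
  have h3 : HasSum (fun k : ℕ => x ^ 2 / 2 * (x / 3) ^ k) (x ^ 2 / 2 * (1 - x / 3)⁻¹) :=
    (hasSum_geometric_of_lt_one (by positivity) (by linarith)).mul_left _
  have h4 := hasSum_le (fun k => ?_) h2 h3
  · have h5 : x ^ 2 / 2 * (1 - x / 3)⁻¹ = x ^ 2 / (2 * (1 - x / 3)) := by
      rw [← div_eq_mul_inv, div_div]
    rw [h5] at h4
    simp [Finset.sum_range_succ] at h4
    linarith
  · have h6 : ((2 * 3 ^ k : ℕ) : ℝ) ≤ ((k + 2).factorial : ℝ) := by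
      exact_mod_cast Nat.two_mul_three_pow_le_factorial k
    push_cast at h6
    calc x ^ (k + 2) / ((k + 2).factorial : ℝ) ≤ x ^ (k + 2) / (2 * 3 ^ k) := by gcongr
      _ = x ^ 2 / 2 * (x / 3) ^ k := by rw [pow_add, div_pow]; field_simp

namespace TriggeringInstance

variable {V : Type*} [Fintype V] [DecidableEq V] [Nonempty V]

theorem expect_sampleLoop_steps (I : TriggeringInstance V) (drawTime : V → ℕ) (t : ℕ)
    (est : V → ℕ) :
    ((I.sampleLoop drawTime t est).expect fun o => (o.2 : ℝ≥0∞)) = t * I.rrCost drawTime := by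
  induction t generalizing est with
  | zero => simp [sampleLoop, PMF.expect_pure]
  | succ t ih =>
    rw [sampleLoop, PMF.expect_bind]
    simp only [PMF.expect_bind, PMF.expect_pure]
    push_cast
    simp only [PMF.expect_add, PMF.expect_const, ih]
    rw [add_mul, one_mul, add_comm, rrCost]
    simp only [Nat.cast_add, PMF.expect_add]

/-- Consecutive batches form one long run, so the rounds of Phase 1 can be compared with a run that
never stops. -/
theorem expect_sampleLoop_add (I : TriggeringInstance V) (drawTime : V → ℕ) (s t : ℕ)
    (est : V → ℕ) (f : (V → ℕ) → ℝ≥0∞) :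
    ((I.sampleLoop drawTime s est).expect fun o =>
      (I.sampleLoop drawTime t o.1).expect fun o' => f o'.1)
      = (I.sampleLoop drawTime (s + t) est).expect fun o => f o.1 := by
  induction s generalizing est with
  | zero => rw [zero_add, sampleLoop, PMF.expect_pure]
  | succ s ih =>
    rw [show s + 1 + t = (s + t) + 1 by ring, sampleLoop, sampleLoop]
    simp only [PMF.expect_bind, PMF.expect_pure, ih]

theorem prob_sampleLoop_add (I : TriggeringInstance V) (drawTime : V → ℕ) (s t : ℕ)
    (est : V → ℕ) (A : Set (V → ℕ)) :
    ((I.sampleLoop drawTime s est).expect fun o =>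
      (I.sampleLoop drawTime t o.1).prob {o | o.1 ∈ A})
      = (I.sampleLoop drawTime (s + t) est).prob {o | o.1 ∈ A} :=
  I.expect_sampleLoop_add drawTime s t est (A.indicator 1)

theorem expect_sampleLoop_est (I : TriggeringInstance V) (drawTime : V → ℕ) (t : ℕ)
    (est : V → ℕ) (v : V) :
    ((I.sampleLoop drawTime t est).expect fun o => (o.1 v : ℝ≥0∞))
      = est v + t * ENNReal.ofReal (I.sni v / Fintype.card V) := by
  induction t generalizing est with
  | zero => simp [sampleLoop, PMF.expect_pure]
  | succ t ih =>
    rw [sampleLoop]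
    simp only [PMF.expect_bind, PMF.expect_pure, ih, PMF.expect_add, PMF.expect_const]
    have h : ∀ r : Finset V × ℕ, ((if v ∈ r.1 then est v + 1 else est v : ℕ) : ℝ≥0∞)
        = est v + ({o | v ∈ o.1} : Set (Finset V × ℕ)).indicator 1 r := fun r => by
      by_cases hv : v ∈ r.1 <;> simp [hv]
    simp only [h, PMF.expect_add, PMF.expect_const]
    change (est v : ℝ≥0∞) + (I.randomRR drawTime).prob {o | v ∈ o.1} + _ = _
    rw [prob_mem_randomRR]
    push_cast
    ring

theorem expect_sampleLoop_pow (I : TriggeringInstance V) (drawTime : V → ℕ) (t : ℕ)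
    (est : V → ℕ) (v : V) (z : ℝ≥0∞) :
    ((I.sampleLoop drawTime t est).expect fun o => z ^ (o.1 v))
      = z ^ (est v) * ((I.randomRR drawTime).expect fun r => if v ∈ r.1 then z else 1) ^ t := by
  induction t generalizing est with
  | zero => simp [sampleLoop, PMF.expect_pure]
  | succ t ih =>
    rw [sampleLoop]
    simp only [PMF.expect_bind, PMF.expect_pure, ih, PMF.expect_mul_const]
    have h : ∀ r : Finset V × ℕ, z ^ (if v ∈ r.1 then est v + 1 else est v)
        = z ^ est v * if v ∈ r.1 then z else 1 := fun r => by
      by_cases hv : v ∈ r.1 <;> simp [hv, pow_succ]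
    simp only [h, PMF.expect_const_mul]
    ring

theorem expect_randomRR_ite (I : TriggeringInstance V) (drawTime : V → ℕ) (v : V) {z : ℝ}
    (hz : 0 ≤ z) :
    ((I.randomRR drawTime).expect fun r => if v ∈ r.1 then ENNReal.ofReal z else 1)
      = ENNReal.ofReal (1 + I.sni v / Fintype.card V * (z - 1)) := by
  set p : ℝ := I.sni v / Fintype.card V with hp
  have hn : (0 : ℝ) < Fintype.card V := by exact_mod_cast Fintype.card_pos
  have hp0 : 0 ≤ p := by have := I.one_le_sni v; positivity
  have hp1 : p ≤ 1 := by rw [hp, div_le_one hn]; exact I.sni_le_card v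
  have h1 := I.prob_mem_randomRR drawTime v
  have h2 := (I.randomRR drawTime).prob_add_prob_compl {o | v ∈ o.1}
  rw [h1, ← hp] at h2
  have h3 : (I.randomRR drawTime).prob {o | v ∈ o.1}ᶜ = ENNReal.ofReal (1 - p) := by
    rw [ENNReal.ofReal_sub _ hp0, ENNReal.ofReal_one, ← h2,
      ENNReal.add_sub_cancel_left ENNReal.ofReal_ne_top]
  have h4 : ∀ r : Finset V × ℕ, (if v ∈ r.1 then ENNReal.ofReal z else 1)
      = ENNReal.ofReal z * ({o | v ∈ o.1} : Set (Finset V × ℕ)).indicator 1 r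
        + ({o | v ∈ o.1}ᶜ : Set (Finset V × ℕ)).indicator 1 r := fun r => by
    by_cases hv : v ∈ r.1 <;> simp [hv]
  simp only [h4, PMF.expect_add, PMF.expect_const_mul]
  change ENNReal.ofReal z * (I.randomRR drawTime).prob {o | v ∈ o.1}
    + (I.randomRR drawTime).prob {o | v ∈ o.1}ᶜ = _
  rw [h1, h3, ← ENNReal.ofReal_mul hz, ← ENNReal.ofReal_add (by positivity) (by linarith)]
  congr 1
  ring

/-- Chernoff's bound for the number of RR sets that contain `v`. -/
theorem sampleLoop_chernoff (I : TriggeringInstance V) (drawTime : V → ℕ) (t : ℕ) (v : V)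
    (lam a : ℝ) :
    (I.sampleLoop drawTime t fun _ => 0).prob {o | lam * a ≤ lam * o.1 v}
      ≤ ENNReal.ofReal (Real.exp
        (t * (I.sni v / Fintype.card V * (Real.exp lam - 1)) - lam * a)) := by
  set p : ℝ := I.sni v / Fintype.card V with hp
  have hn : (0 : ℝ) < Fintype.card V := by exact_mod_cast Fintype.card_pos
  have hp0 : 0 ≤ p := by have := I.one_le_sni v; positivity
  have hp1 : p ≤ 1 := by rw [hp, div_le_one hn]; exact I.sni_le_card v
  -- Markov's inequality for `exp (lam * est v)`. The sign of `lam` is left free, so both tails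
  -- follow.
  have h1 : (I.sampleLoop drawTime t fun _ => 0).prob {o | lam * a ≤ lam * o.1 v}
      ≤ (I.sampleLoop drawTime t fun _ => 0).expect fun o =>
        ENNReal.ofReal (Real.exp (-(lam * a))) * ENNReal.ofReal (Real.exp lam) ^ (o.1 v) := by
    refine PMF.prob_le_expect _ fun o ho => ?_
    rw [← ENNReal.ofReal_pow (Real.exp_pos _).le, ← Real.exp_nat_mul,
      ← ENNReal.ofReal_mul (Real.exp_pos _).le, ← Real.exp_add, ENNReal.one_le_ofReal,
      Real.one_le_exp_iff]
    have : lam * a ≤ lam * o.1 v := ho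
    linarith
  refine h1.trans ?_
  rw [PMF.expect_const_mul, expect_sampleLoop_pow, expect_randomRR_ite _ _ _ (Real.exp_pos _).le,
    ← hp, pow_zero, one_mul]
  have h2 : 1 + p * (Real.exp lam - 1) ≤ Real.exp (p * (Real.exp lam - 1)) := by
    linarith [Real.add_one_le_exp (p * (Real.exp lam - 1))]
  have h3 : 0 ≤ 1 + p * (Real.exp lam - 1) := by nlinarith [Real.exp_pos lam]
  rw [← ENNReal.ofReal_pow h3, ← ENNReal.ofReal_mul (Real.exp_pos _).le]
  refine ENNReal.ofReal_le_ofReal ?_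
  rw [sub_eq_neg_add (t * (p * (Real.exp lam - 1))), Real.exp_add, Real.exp_nat_mul]
  gcongr

/-- The scale `y` may exceed the mean: only the nonnegative term `exp lam - 1 - lam` is multiplied
by the mean, so there the mean may be replaced by `y`. -/
theorem sampleLoop_upper_tail (I : TriggeringInstance V) (drawTime : V → ℕ) (t : ℕ) (v : V)
    {ε y : ℝ} (hε : 0 < ε) (hy : I.sni v / Fintype.card V ≤ y) :
    (I.sampleLoop drawTime t fun _ => 0).prob
        {o | t * (I.sni v / Fintype.card V + ε * y) ≤ o.1 v}
      ≤ ENNReal.ofReal (Real.exp (-(ε ^ 2 * t * y / (2 + 2 / 3 * ε)))) := by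
  set p : ℝ := I.sni v / Fintype.card V with hp
  have hn : (0 : ℝ) < Fintype.card V := by exact_mod_cast Fintype.card_pos
  have hp0 : 0 ≤ p := by have := I.one_le_sni v; positivity
  -- Bernstein's choice: with `B = ε² / (2 + 2ε/3)`, the quadratic term of the bound on `exp lam` is
  -- `B` and `lam * ε = 2B`, which leaves `-B`.
  set lam : ℝ := ε / (1 + ε / 3) with hlam
  have hl0 : 0 < lam := by positivity
  have hl3 : lam < 3 := by rw [hlam, div_lt_iff₀ (by positivity)]; linarith
  refine (PMF.prob_mono _ ?_).trans
    ((I.sampleLoop_chernoff drawTime t v lam (t * (p + ε * y))).trans ?_)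
  · intro o ho
    exact mul_le_mul_of_nonneg_left ho hl0.le
  refine ENNReal.ofReal_le_ofReal (Real.exp_le_exp.2 ?_)
  rw [← hp]
  have hb := Real.exp_le_bernstein hl0.le hl3
  have h1 : lam ^ 2 / (2 * (1 - lam / 3)) = ε ^ 2 / (2 + 2 / 3 * ε) := by
    have : 1 - lam / 3 = 1 / (1 + ε / 3) := by rw [hlam]; field_simp; ring
    rw [this, hlam]
    field_simp
  have h2 : lam * ε = 2 * (ε ^ 2 / (2 + 2 / 3 * ε)) := by
    rw [hlam]; field_simp
  rw [h1] at hb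
  have hg : 0 ≤ Real.exp lam - 1 - lam := by linarith [Real.add_one_le_exp lam]
  set B := ε ^ 2 / (2 + 2 / 3 * ε) with hB
  have h3 : p * (Real.exp lam - 1) - lam * (p + ε * y) ≤ -(B * y) := by
    have h5 : lam * (ε * y) = 2 * B * y := by rw [← h2]; ring
    have h4 : p * (Real.exp lam - 1 - lam) ≤ y * B :=
      mul_le_mul hy (by linarith) hg (hp0.trans hy)
    linarith
  have h6 : ε ^ 2 * t * y / (2 + 2 / 3 * ε) = t * (B * y) := by rw [hB]; ring
  rw [h6]
  have h7 := mul_le_mul_of_nonneg_left h3 (Nat.cast_nonneg (α := ℝ) t)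
  linarith

theorem sampleLoop_lower_tail (I : TriggeringInstance V) (drawTime : V → ℕ) (t : ℕ) (v : V)
    {ε y : ℝ} (hε : 0 < ε) (hy : I.sni v / Fintype.card V ≤ y) :
    (I.sampleLoop drawTime t fun _ => 0).prob
        {o | o.1 v ≤ t * (I.sni v / Fintype.card V - ε * y)}
      ≤ ENNReal.ofReal (Real.exp (-(ε ^ 2 * t * y / 2))) := by
  set p : ℝ := I.sni v / Fintype.card V with hp
  have hn : (0 : ℝ) < Fintype.card V := by exact_mod_cast Fintype.card_pos
  have hp0 : 0 ≤ p := by have := I.one_le_sni v; positivity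
  refine (PMF.prob_mono _ ?_).trans
    ((I.sampleLoop_chernoff drawTime t v (-ε) (t * (p - ε * y))).trans ?_)
  · intro o ho
    have ho' : (o.1 v : ℝ) ≤ t * (p - ε * y) := ho
    exact mul_le_mul_of_nonpos_left ho' (by linarith)
  refine ENNReal.ofReal_le_ofReal (Real.exp_le_exp.2 ?_)
  rw [← hp]
  have hb := Real.exp_neg_le_quadratic hε.le
  have hg : 0 ≤ Real.exp (-ε) - 1 + ε := by linarith [Real.add_one_le_exp (-ε)]
  have h3 : p * (Real.exp (-ε) - 1) + ε * (p - ε * y) ≤ -(ε ^ 2 * y / 2) := by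
    have h4 : p * (Real.exp (-ε) - 1 + ε) ≤ y * (ε ^ 2 / 2) :=
      mul_le_mul hy (by linarith) hg (hp0.trans hy)
    linarith
  have h7 := mul_le_mul_of_nonneg_left h3 (Nat.cast_nonneg (α := ℝ) t)
  linarith

end TriggeringInstance

end

/-! ### Correctness of the two phases: robustness and unbiasedness -/

noncomputable section

/-- A sample size computed for `x` makes the tail exponent at least `A` at every scale `y ≥ x`. -/
theorem le_of_sampleSize {n A e x y : ℝ} (hn : 0 < n) (he : 0 < e) (hx : 0 < x)
    (hxy : x ≤ y) :
    A ≤ e ^ 2 * (⌈n * A * (2 + 2 / 3 * e) / (e ^ 2 * x)⌉₊ : ℝ) * (y / n) / (2 + 2 / 3 * e) := by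
  have h := Nat.le_ceil (n * A * (2 + 2 / 3 * e) / (e ^ 2 * x))
  set N : ℝ := (⌈n * A * (2 + 2 / 3 * e) / (e ^ 2 * x)⌉₊ : ℝ)
  rw [div_le_iff₀ (by positivity)] at h
  rw [le_div_iff₀ (by positivity), mul_div_assoc', le_div_iff₀ hn]
  have hN : 0 ≤ N := Nat.cast_nonneg _
  calc A * (2 + 2 / 3 * e) * n = n * A * (2 + 2 / 3 * e) := by ring
    _ ≤ N * (e ^ 2 * x) := h
    _ ≤ N * (e ^ 2 * y) := by gcongr
    _ = _ := by ring

namespace TriggeringInstance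

/-- Monotonicity makes the truncated differences of round sizes telescope. A nonpositive numerator
is rounded up to `0`, so no assumption on the parameters is required. -/
theorem roundSize_mono (n : ℕ) (ε ℓ : ℝ) : Monotone (roundSize n ε ℓ) := by
  refine monotone_nat_of_le_succ fun i => ?_
  cases i with
  | zero => exact Nat.zero_le _
  | succ i =>
    simp only [roundSize]
    set N : ℝ := (n : ℝ) * ((ℓ + 1) * Real.log n + Real.log (Real.logb 2 n) + Real.log 2)
        * (2 + 2 / 3 * (√2 * ε))
    have h : ∀ j : ℕ, N / ((√2 * ε) ^ 2 * ((n : ℝ) / 2 ^ j))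
        = N / ((√2 * ε) ^ 2 * n) * 2 ^ j := fun j => by
      rw [mul_div_assoc', div_div_eq_mul_div]; ring
    rw [h, h]
    set c := N / ((√2 * ε) ^ 2 * n)
    rcases le_total 0 c with hc | hc
    · gcongr
      · norm_num
      · omega
    · rw [Nat.ceil_eq_zero.2 (mul_nonpos_of_nonpos_of_nonneg hc (by positivity))]
      exact Nat.zero_le _

/-- The exponent `(ℓ + 1) ln n + ln log₂ n + ln 2` in the sample sizes of Phase 1. -/
def roundExponent (n : ℕ) (ℓ : ℝ) : ℝ :=
  (ℓ + 1) * Real.log n + Real.log (Real.logb 2 n) + Real.log 2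

theorem one_le_logb_two {n : ℕ} (hn : 2 ≤ n) : 1 ≤ Real.logb 2 n := by
  rw [Real.le_logb_iff_rpow_le one_lt_two (by positivity), Real.rpow_one]
  exact_mod_cast hn

theorem roundExponent_pos {n : ℕ} (hn : 2 ≤ n) {ℓ : ℝ} (hℓ : 0 < ℓ) :
    0 < roundExponent n ℓ := by
  have h1 : 0 ≤ Real.log n := Real.log_natCast_nonneg n
  have h2 := Real.log_nonneg (one_le_logb_two hn)
  have h3 := Real.log_pos one_lt_two
  unfold roundExponent
  positivity

/-- The factors of the denominator pay for the two phases, the nodes, the target `n ^ ℓ` and the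
rounds. -/
theorem exp_neg_roundExponent {n : ℕ} (hn : 2 ≤ n) (ℓ : ℝ) :
    Real.exp (-roundExponent n ℓ) = 1 / (2 * n * (n : ℝ) ^ ℓ * Real.logb 2 n) := by
  have h0 : (0 : ℝ) < n := by positivity
  have h1 : 0 < Real.logb 2 n := one_pos.trans_le (one_le_logb_two hn)
  rw [roundExponent, Real.exp_neg, Real.exp_add, Real.exp_add, Real.exp_log h1,
    Real.exp_log two_pos, mul_comm (ℓ + 1), ← Real.rpow_def_of_pos h0, Real.rpow_add h0,
    Real.rpow_one, ← one_div]
  congr 1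
  ring

theorem one_le_card_div_two_pow {n i : ℕ} (hn : n ≠ 0) (hi : i ≤ Nat.log 2 n) :
    (1 : ℝ) ≤ n / 2 ^ i := by
  rw [le_div_iff₀ (by positivity), one_mul]
  exact_mod_cast Nat.pow_le_of_le_log hn hi

variable {V : Type*} [Fintype V] [DecidableEq V] [Nonempty V]

theorem one_le_kthLargest_sni (I : TriggeringInstance V) {k : ℕ} (hk : 1 ≤ k)
    (hkn : k ≤ Fintype.card V) : 1 ≤ kthLargest I.sni k := by
  obtain ⟨⟨S, hS, _⟩, h2⟩ := kthLargest_spec I.sni hk hkn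
  obtain ⟨v, _, hv⟩ := h2 S hS
  exact (I.one_le_sni v).trans hv

theorem kthLargest_sni_le_card (I : TriggeringInstance V) {k : ℕ} (hk : 1 ≤ k)
    (hkn : k ≤ Fintype.card V) : kthLargest I.sni k ≤ Fintype.card V := by
  obtain ⟨⟨S, hS, h1⟩, _⟩ := kthLargest_spec I.sni hk hkn
  obtain ⟨v, hv⟩ : S.Nonempty := Finset.card_pos.1 (by omega)
  exact (h1 v hv).trans (I.sni_le_card v)

/-- The estimates after round `i` for which Phase 1 stops with a lower bound that is at least
`max (n / 2 ^ i) ψ⁽ᵏ⁾`. -/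
def Overestimates (I : TriggeringInstance V) (ε ℓ : ℝ) (k i : ℕ) : Set (V → ℕ) :=
  {est | (1 + √2 * ε) * max ((Fintype.card V : ℝ) / 2 ^ i) (kthLargest I.sni k)
    ≤ (Fintype.card V : ℝ) * (kthLargest est k : ℕ) / (roundSize (Fintype.card V) ε ℓ i : ℝ)}

/-- A union bound over the rounds. Dropping the condition that earlier rounds did not stop only
increases each term and leaves an event about an unstopped run. The default `LB = 1` is safe because
`ψ⁽ᵏ⁾ ≥ 1`. -/
theorem prob_phaseOne_gt_le (I : TriggeringInstance V) (drawTime : V → ℕ) {ε : ℝ} (hε : 0 < ε)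
    (ℓ : ℝ) (k r i : ℕ) (est : V → ℕ) (hψ : 1 ≤ kthLargest I.sni k) :
    (I.phaseOne drawTime ε ℓ k r (i + 1) est).prob {q | kthLargest I.sni k < q.1}
      ≤ ∑ j ∈ Finset.range r,
        (I.sampleLoop drawTime (roundSize (Fintype.card V) ε ℓ (i + 1 + j)
          - roundSize (Fintype.card V) ε ℓ i) est).prob
          {o | o.1 ∈ I.Overestimates ε ℓ k (i + 1 + j)} := by
  induction r generalizing i est with
  | zero =>
    rw [phaseOne, PMF.prob_pure]
    simp [hψ]
  | succ r ih =>
    rw [phaseOne, PMF.prob_bind, add_tsub_cancel_right, Finset.sum_range_succ']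
    set n := Fintype.card V
    set θ := roundSize n ε ℓ
    have hb : 0 < 1 + √2 * ε := by positivity
    -- The failure terms of later rounds, averaged over the present batch.
    have h1 : ∀ j, (I.sampleLoop drawTime (θ (i + 1 + (j + 1)) - θ i) est).prob
          {o | o.1 ∈ I.Overestimates ε ℓ k (i + 1 + (j + 1))}
        = (I.sampleLoop drawTime (θ (i + 1) - θ i) est).expect fun o =>
          (I.sampleLoop drawTime (θ (i + 1 + 1 + j) - θ (i + 1)) o.1).prob
            {o | o.1 ∈ I.Overestimates ε ℓ k (i + 1 + 1 + j)} := fun j => by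
      rw [prob_sampleLoop_add, show i + 1 + 1 + j = i + 1 + (j + 1) by ring]
      have h2 : θ i ≤ θ (i + 1) := roundSize_mono _ _ _ (by omega)
      have h3 : θ (i + 1) ≤ θ (i + 1 + (j + 1)) := roundSize_mono _ _ _ (by omega)
      rw [show θ (i + 1) - θ i + (θ (i + 1 + (j + 1)) - θ (i + 1))
        = θ (i + 1 + (j + 1)) - θ i by omega]
    simp only [h1]
    rw [← PMF.expect_sum, add_zero, PMF.prob, ← PMF.expect_add]
    refine PMF.expect_mono _ fun o => ?_
    split_ifs with hmet
    · rw [PMF.prob_pure]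
      by_cases hgt : kthLargest I.sni k
          < (n : ℝ) * (kthLargest o.1 k : ℕ) / ((θ (i + 1) : ℝ) * (1 + √2 * ε))
      · have hmem : o.1 ∈ I.Overestimates ε ℓ k (i + 1) := by
          change (1 + √2 * ε) * max _ _ ≤ _
          rw [mul_max_of_nonneg _ _ hb.le, max_le_iff]
          refine ⟨hmet, ?_⟩
          rw [← div_div, lt_div_iff₀ hb] at hgt
          linarith
        simp [hgt, hmem]
      · simp [hgt]
    · rw [PMF.prob_bind]
      refine le_add_right ?_
      refine (le_of_eq ?_).trans (ih (i + 1) o.1)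
      refine congrArg (PMF.expect _) (funext fun q => ?_)
      rw [PMF.prob_pure]
      simp [Set.indicator]

theorem phaseOne_support (I : TriggeringInstance V) (drawTime : V → ℕ) {ε : ℝ} (hε : 0 < ε)
    (ℓ : ℝ) (k r i : ℕ) (est : V → ℕ) (hr : i + r ≤ Nat.log 2 (Fintype.card V)) :
    ∀ q ∈ (I.phaseOne drawTime ε ℓ k r (i + 1) est).support, 1 ≤ q.1 := by
  induction r generalizing i est with
  | zero =>
    intro q hq
    rw [phaseOne, PMF.support_pure, Set.mem_singleton_iff] at hq
    simp [hq]
  | succ r ih =>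
    intro q hq
    rw [phaseOne, PMF.mem_support_bind_iff] at hq
    obtain ⟨o, _, hq⟩ := hq
    have hb : 0 < 1 + √2 * ε := by positivity
    dsimp only at hq
    split_ifs at hq with hmet
    · rw [PMF.support_pure, Set.mem_singleton_iff] at hq
      rw [hq, ← div_div]
      dsimp only
      rw [le_div_iff₀ hb]
      have := one_le_card_div_two_pow (n := Fintype.card V) Fintype.card_ne_zero
        (show i + 1 ≤ _ by omega)
      nlinarith
    · rw [PMF.mem_support_bind_iff] at hq
      obtain ⟨q', hq', hq⟩ := hq
      rw [PMF.support_pure, Set.mem_singleton_iff] at hq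
      rw [hq]
      exact ih (i + 1) o.1 (by omega) q' hq'

/-- Among `k` nodes whose estimates reach the `k`-th largest estimate, one has `ψ_v ≤ ψ⁽ᵏ⁾`, and it
must be overestimated by `ε' y`. -/
theorem prob_overestimates_le (I : TriggeringInstance V) (drawTime : V → ℕ) {ε : ℝ}
    (hε : 0 < ε) (ℓ : ℝ) {k : ℕ} (hk : 1 ≤ k) (hkn : k ≤ Fintype.card V)
    (hn : 2 ≤ Fintype.card V) (i : ℕ) :
    (I.sampleLoop drawTime (roundSize (Fintype.card V) ε ℓ (i + 1)) fun _ => 0).prob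
        {o | o.1 ∈ I.Overestimates ε ℓ k (i + 1)}
      ≤ ENNReal.ofReal
        (1 / (2 * (Fintype.card V : ℝ) ^ ℓ * Real.logb 2 (Fintype.card V))) := by
  classical
  set n := Fintype.card V with hndef
  have hn0 : (0 : ℝ) < n := by positivity
  set θ := roundSize n ε ℓ (i + 1) with hθ
  set e := √2 * ε
  have he : 0 < e := by positivity
  -- The threshold in the maximum makes the sample large enough; `ψ⁽ᵏ⁾` makes `y` dominate the mean.
  set y : ℝ := max ((n : ℝ) / 2 ^ (i + 1)) (kthLargest I.sni k) with hy
  have hx0 : 0 < (n : ℝ) / 2 ^ (i + 1) := by positivity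
  have hy0 : 0 < y := hx0.trans_le (le_max_left _ _)
  set P := I.sampleLoop drawTime θ fun _ => 0
  have hA : roundExponent n ℓ ≤ e ^ 2 * θ * (y / n) / (2 + 2 / 3 * e) :=
    le_of_sampleSize hn0 he hx0 (le_max_left _ _)
  have hsub : {o : (V → ℕ) × ℕ | o.1 ∈ I.Overestimates ε ℓ k (i + 1)}
      ⊆ ⋃ v ∈ Finset.univ.filter (fun v => I.sni v ≤ kthLargest I.sni k),
        {o | θ * (I.sni v / n + e * (y / n)) ≤ o.1 v} := by
    intro o ho
    have ho' : (1 + e) * y ≤ n * (kthLargest o.1 k : ℕ) / θ := ho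
    have hθ0 : (0 : ℝ) < θ := by
      rcases (Nat.cast_nonneg (α := ℝ) θ).eq_or_lt with h | h
      · rw [← h, div_zero] at ho'
        exact absurd ho' (not_le.2 (by positivity))
      · exact h
    obtain ⟨⟨S, hS, h1⟩, _⟩ := kthLargest_spec o.1 hk hkn
    obtain ⟨v, hv, hvψ⟩ := (kthLargest_spec I.sni hk hkn).2 S hS
    refine Set.mem_iUnion₂.2 ⟨v, by simp [hvψ], ?_⟩
    have h2 : ((kthLargest o.1 k : ℕ) : ℝ) ≤ o.1 v := by exact_mod_cast h1 v hv
    have h3 : I.sni v ≤ y := hvψ.trans (le_max_right _ _)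
    rw [le_div_iff₀ hθ0] at ho'
    change θ * (I.sni v / n + e * (y / n)) ≤ (o.1 v : ℝ)
    refine le_trans ?_ h2
    rw [mul_div_assoc', ← add_div, mul_div_assoc', div_le_iff₀ hn0]
    have h4 : (θ : ℝ) * I.sni v ≤ θ * y := by gcongr
    linarith
  refine (P.prob_mono hsub).trans ((P.prob_biUnion_le _ _).trans ?_)
  have hv : ∀ v ∈ Finset.univ.filter (fun v => I.sni v ≤ kthLargest I.sni k),
      P.prob {o | θ * (I.sni v / n + e * (y / n)) ≤ o.1 v}
        ≤ ENNReal.ofReal (Real.exp (-roundExponent n ℓ)) := by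
    intro v hv
    have h3 : I.sni v / n ≤ y / n := by
      gcongr
      exact (Finset.mem_filter.1 hv).2.trans (le_max_right _ _)
    refine (I.sampleLoop_upper_tail drawTime θ v he h3).trans (ENNReal.ofReal_le_ofReal ?_)
    rw [Real.exp_le_exp]
    linarith
  refine (Finset.sum_le_card_nsmul _ _ _ hv).trans ?_
  rw [nsmul_eq_mul, exp_neg_roundExponent hn]
  have hcard : (((Finset.univ.filter fun v => I.sni v ≤ kthLargest I.sni k).card : ℕ) : ℝ≥0∞)
      ≤ ENNReal.ofReal n := by
    rw [ENNReal.ofReal_natCast]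
    exact_mod_cast Finset.card_le_univ _
  refine (mul_le_mul_left hcard _).trans (le_of_eq ?_)
  rw [← ENNReal.ofReal_mul hn0.le]
  congr 1
  field_simp

/-- Phase 1 returns a lower bound of `ψ⁽ᵏ⁾`, except with probability `1 / (2 n ^ ℓ)`. -/
theorem prob_phaseOne_fails (I : TriggeringInstance V) (drawTime : V → ℕ) {ε : ℝ}
    (hε : 0 < ε) (ℓ : ℝ) {k : ℕ} (hk : 1 ≤ k) (hkn : k ≤ Fintype.card V) :
    (I.phaseOne drawTime ε ℓ k (Nat.log 2 (Fintype.card V) - 1) 1 fun _ => 0).prob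
        {q | kthLargest I.sni k < q.1}
      ≤ ENNReal.ofReal (1 / (2 * (Fintype.card V : ℝ) ^ ℓ)) := by
  refine (I.prob_phaseOne_gt_le drawTime hε ℓ k _ 0 _ (I.one_le_kthLargest_sni hk hkn)).trans ?_
  -- For `n = 1` there are no rounds, while `logb 2 n` vanishes and could not serve as a
  -- denominator.
  rcases lt_or_ge (Fintype.card V) 2 with hn | hn
  · have : Nat.log 2 (Fintype.card V) = 0 := Nat.log_of_lt hn
    simp [this]
  refine (Finset.sum_le_card_nsmul _ _
    (ENNReal.ofReal (1 / (2 * (Fintype.card V : ℝ) ^ ℓ * Real.logb 2 (Fintype.card V))))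
    fun j _ => ?_).trans ?_
  · have := I.prob_overestimates_le drawTime hε ℓ hk hkn hn j
    rw [show 0 + 1 + j = j + 1 by ring, show roundSize (Fintype.card V) ε ℓ 0 = 0 from rfl,
      Nat.sub_zero]
    exact this
  · have h1 : 0 < Real.logb 2 (Fintype.card V) := one_pos.trans_le (one_le_logb_two hn)
    have h2 : ((Nat.log 2 (Fintype.card V) - 1 : ℕ) : ℝ) ≤ Real.logb 2 (Fintype.card V) := by
      refine le_trans ?_ (Real.natLog_le_logb (Fintype.card V) 2)
      exact_mod_cast Nat.sub_le _ _
    rw [Finset.card_range, nsmul_eq_mul, ← ENNReal.ofReal_natCast,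
      ← ENNReal.ofReal_mul (Nat.cast_nonneg _)]
    refine ENNReal.ofReal_le_ofReal ?_
    have h3 : (0 : ℝ) < (Fintype.card V : ℝ) ^ ℓ := by positivity
    rw [mul_one_div, div_le_div_iff₀ (by positivity) (by positivity)]
    nlinarith

theorem finalExponent_pos (n : ℕ) {ℓ : ℝ} (hℓ : 0 < ℓ) :
    0 < (ℓ + 1) * Real.log n + Real.log 4 := by
  have h1 : 0 ≤ Real.log n := Real.log_natCast_nonneg n
  have h2 : 0 < Real.log 4 := Real.log_pos (by norm_num)
  positivity

theorem finalSize_pos {n : ℕ} (hn : 0 < n) {ε ℓ LB : ℝ} (hε : 0 < ε) (hℓ : 0 < ℓ)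
    (hLB : 0 < LB) : 0 < finalSize n ε ℓ LB := by
  have := finalExponent_pos n hℓ
  exact Nat.ceil_pos.2 (by positivity)

/-- With a lower bound of `ψ⁽ᵏ⁾`, the estimates of Phase 2 are robust, except with probability
`1 / (2 n ^ ℓ)`. -/
theorem prob_finalEstimate_fails (I : TriggeringInstance V) (drawTime : V → ℕ) {ε ℓ LB : ℝ}
    (hε : 0 < ε) (hℓ : 0 < ℓ) (hLB : 0 < LB) {k : ℕ} (hLBk : LB ≤ kthLargest I.sni k) :
    (I.sampleLoop drawTime (finalSize (Fintype.card V) ε ℓ LB) fun _ => 0).prob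
        {o | ¬ I.Robust ε k fun v =>
          (Fintype.card V : ℝ) * (o.1 v : ℝ) / (finalSize (Fintype.card V) ε ℓ LB : ℝ)}
      ≤ ENNReal.ofReal (1 / (2 * (Fintype.card V : ℝ) ^ ℓ)) := by
  set n := Fintype.card V with hndef
  have hnpos : 0 < n := Fintype.card_pos
  have hn0 : (0 : ℝ) < n := by positivity
  set θ := finalSize n ε ℓ LB with hθ
  have hθ0 : (0 : ℝ) < θ := by exact_mod_cast finalSize_pos hnpos hε hℓ hLB
  set P := I.sampleLoop drawTime θ fun _ => 0
  -- The scale `max ψ_v ψ⁽ᵏ⁾` merges both cases of robustness into one deviation bound.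
  set y : V → ℝ := fun v => max (I.sni v) (kthLargest I.sni k) with hy
  set A : ℝ := (ℓ + 1) * Real.log n + Real.log 4 with hAdef
  have hA0 : 0 < A := finalExponent_pos n hℓ
  have hA : ∀ v, A ≤ ε ^ 2 * θ * (y v / n) / (2 + 2 / 3 * ε) := fun v =>
    le_of_sampleSize hn0 hε hLB (hLBk.trans (le_max_right _ _))
  have hy0 : ∀ v, 0 < y v := fun v => hLB.trans_le (hLBk.trans (le_max_right _ _))
  have hyn : ∀ v, I.sni v / n ≤ y v / n := fun v => by
    gcongr
    exact le_max_left _ _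
  have hsub : {o : (V → ℕ) × ℕ | ¬ I.Robust ε k fun v => (n : ℝ) * (o.1 v : ℝ) / (θ : ℝ)}
      ⊆ ⋃ v ∈ (Finset.univ : Finset V), ({o | θ * (I.sni v / n + ε * (y v / n)) ≤ o.1 v}
        ∪ {o | o.1 v ≤ θ * (I.sni v / n - ε * (y v / n))}) := by
    intro o ho
    by_contra hcon
    simp only [Set.mem_iUnion, Set.mem_union, Set.mem_ofPred_eq, not_exists, not_or, not_le] at hcon
    refine ho fun v => ?_
    have key : |(n : ℝ) * (o.1 v : ℝ) / (θ : ℝ) - I.sni v| ≤ ε * y v := by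
      obtain ⟨h1, h2⟩ := hcon v (Finset.mem_univ v)
      have e1 : I.sni v / n + ε * (y v / n) = (I.sni v + ε * y v) / n := by ring
      have e2 : I.sni v / n - ε * (y v / n) = (I.sni v - ε * y v) / n := by ring
      rw [e1, mul_div_assoc', lt_div_iff₀ hn0] at h1
      rw [e2, mul_div_assoc', div_lt_iff₀ hn0] at h2
      rw [abs_sub_le_iff, sub_le_iff_le_add, div_le_iff₀ hθ0, sub_le_comm, le_div_iff₀ hθ0]
      constructor <;> linarith
    constructor
    · intro h
      simpa only [hy, max_eq_left_of_lt h] using key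
    · intro h
      simpa only [hy, max_eq_right h] using key
  refine (P.prob_mono hsub).trans ((P.prob_biUnion_le _ _).trans ?_)
  -- The `4` in the exponent pays for two tails and for half of the failure probability, the factor
  -- `n` for the nodes.
  have hexp : Real.exp (-A) = 1 / (4 * n * (n : ℝ) ^ ℓ) := by
    rw [hAdef, Real.exp_neg, Real.exp_add, Real.exp_log (by norm_num), mul_comm (ℓ + 1),
      ← Real.rpow_def_of_pos hn0, Real.rpow_add hn0, Real.rpow_one, ← one_div]
    congr 1
    ring
  have hv : ∀ v ∈ (Finset.univ : Finset V),
      P.prob ({o | θ * (I.sni v / n + ε * (y v / n)) ≤ o.1 v}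
        ∪ {o | o.1 v ≤ θ * (I.sni v / n - ε * (y v / n))})
        ≤ ENNReal.ofReal (2 * Real.exp (-A)) := by
    intro v _
    rw [two_mul, ENNReal.ofReal_add (Real.exp_pos _).le (Real.exp_pos _).le]
    refine (P.prob_union_le _ _).trans (add_le_add ?_ ?_)
    · refine (I.sampleLoop_upper_tail drawTime θ v hε (hyn v)).trans (ENNReal.ofReal_le_ofReal ?_)
      rw [Real.exp_le_exp]
      linarith [hA v]
    · refine (I.sampleLoop_lower_tail drawTime θ v hε (hyn v)).trans (ENNReal.ofReal_le_ofReal ?_)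
      rw [Real.exp_le_exp, neg_le_neg_iff]
      refine (hA v).trans ?_
      have := hy0 v
      gcongr
      linarith
  refine (Finset.sum_le_card_nsmul _ _ _ hv).trans (le_of_eq ?_)
  rw [nsmul_eq_mul, Finset.card_univ, ← ENNReal.ofReal_natCast, ← ENNReal.ofReal_mul hn0.le, hexp]
  congr 1
  field_simp
  norm_num

theorem one_le_of_mem_support_phaseOne (I : TriggeringInstance V) (drawTime : V → ℕ) {ε : ℝ}
    (hε : 0 < ε) (ℓ : ℝ) (k : ℕ) {q : ℝ × ℕ}
    (hq : q ∈ (I.phaseOne drawTime ε ℓ k (Nat.log 2 (Fintype.card V) - 1) 1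
      fun _ => 0).support) : 1 ≤ q.1 :=
  I.phaseOne_support drawTime hε ℓ k _ 0 _ (by omega) q hq

theorem asniRR_robust (I : TriggeringInstance V) (drawTime : V → ℕ) {ε ℓ : ℝ}
    (hε : 0 < ε) (hℓ : 0 < ℓ) {k : ℕ} (hk : 1 ≤ k) (hkn : k ≤ Fintype.card V) :
    ENNReal.ofReal (1 - 1 / (Fintype.card V : ℝ) ^ ℓ) ≤
      (I.asniRR drawTime ε ℓ k).toOuterMeasure {o | I.Robust ε k o.1} := by
  rw [← PMF.prob_eq_toOuterMeasure]
  have hpow : (0 : ℝ) < (Fintype.card V : ℝ) ^ ℓ :=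
    Real.rpow_pos_of_pos (by exact_mod_cast Fintype.card_pos) _
  have hfail : (I.asniRR drawTime ε ℓ k).prob {o | I.Robust ε k o.1}ᶜ
      ≤ ENNReal.ofReal (1 / (Fintype.card V : ℝ) ^ ℓ) := by
    rw [asniRR, PMF.prob_bind]
    have h1 : ENNReal.ofReal (1 / (Fintype.card V : ℝ) ^ ℓ)
        = ENNReal.ofReal (1 / (2 * (Fintype.card V : ℝ) ^ ℓ))
          + ENNReal.ofReal (1 / (2 * (Fintype.card V : ℝ) ^ ℓ)) := by
      rw [← ENNReal.ofReal_add (by positivity) (by positivity)]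
      congr 1
      field_simp
      norm_num
    rw [h1]
    refine le_trans ?_ (add_le_add_left (I.prob_phaseOne_fails drawTime hε ℓ hk hkn) _)
    rw [PMF.prob, ← PMF.expect_const (I.phaseOne drawTime ε ℓ k
      (Nat.log 2 (Fintype.card V) - 1) 1 fun _ => 0)
      (ENNReal.ofReal (1 / (2 * (Fintype.card V : ℝ) ^ ℓ))), ← PMF.expect_add]
    refine PMF.expect_mono_support _ fun q hq => ?_
    have hq1 := I.one_le_of_mem_support_phaseOne drawTime hε ℓ k hq
    -- For each outcome of Phase 1, either its lower bound is wrong or the fresh samples of Phase 2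
    -- must fail.
    by_cases hgt : kthLargest I.sni k < q.1
    · refine le_add_right ((PMF.prob_le_one _ _).trans ?_)
      simp [hgt]
    · refine le_add_left ?_
      rw [PMF.prob_bind]
      refine le_trans (le_of_eq ?_) (I.prob_finalEstimate_fails drawTime hε hℓ
        (zero_lt_one.trans_le hq1) (not_lt.1 hgt))
      refine congrArg (PMF.expect _) (funext fun o => ?_)
      rw [PMF.prob_pure]
      rfl
  have hsum := (I.asniRR drawTime ε ℓ k).prob_add_prob_compl {o | I.Robust ε k o.1}
  rw [ENNReal.ofReal_sub _ (by positivity), ENNReal.ofReal_one, tsub_le_iff_right, ← hsum]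
  gcongr

theorem asniRR_unbiased (I : TriggeringInstance V) (drawTime : V → ℕ) {ε ℓ : ℝ}
    (hε : 0 < ε) (hℓ : 0 < ℓ) (k : ℕ) (v : V) :
    HasSum (fun o => (I.asniRR drawTime ε ℓ k o).toReal * o.1 v) (I.sni v) := by
  have hn0 : (0 : ℝ) < Fintype.card V := by exact_mod_cast Fintype.card_pos
  have hexp : ((I.asniRR drawTime ε ℓ k).expect fun o => ENNReal.ofReal (o.1 v))
      = ENNReal.ofReal (I.sni v) := by
    rw [asniRR, PMF.expect_bind, ← PMF.expect_const (I.phaseOne drawTime ε ℓ k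
      (Nat.log 2 (Fintype.card V) - 1) 1 fun _ => 0) (ENNReal.ofReal (I.sni v))]
    refine PMF.expect_congr_support _ fun q hq => ?_
    have hq1 := I.one_le_of_mem_support_phaseOne drawTime hε ℓ k hq
    set θ := finalSize (Fintype.card V) ε ℓ q.1
    have hθ0 : (0 : ℝ) < θ := by
      exact_mod_cast finalSize_pos Fintype.card_pos hε hℓ (zero_lt_one.trans_le hq1)
    simp only [PMF.expect_bind, PMF.expect_pure]
    have h1 : ∀ m : ℕ, ENNReal.ofReal ((Fintype.card V : ℝ) * m / θ)
        = ENNReal.ofReal ((Fintype.card V : ℝ) / θ) * m := fun m => by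
      rw [← ENNReal.ofReal_natCast m, ← ENNReal.ofReal_mul (by positivity)]
      congr 1
      ring
    simp only [h1, PMF.expect_const_mul, expect_sampleLoop_est]
    rw [Nat.cast_zero, zero_add, ← ENNReal.ofReal_natCast θ, ← ENNReal.ofReal_mul hθ0.le,
      ← ENNReal.ofReal_mul (by positivity)]
    congr 1
    field_simp
  -- Off the support an outcome may have negative entries, but there its weight is zero.
  have hnonneg : ∀ o ∈ (I.asniRR drawTime ε ℓ k).support, 0 ≤ o.1 v := by
    intro o ho
    simp only [asniRR, PMF.mem_support_bind_iff, PMF.support_pure, Set.mem_singleton_iff] at ho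
    obtain ⟨_, _, _, _, rfl⟩ := ho
    dsimp only
    positivity
  have hfin : ((I.asniRR drawTime ε ℓ k).expect fun o => ENNReal.ofReal (o.1 v)) ≠ ∞ := by
    rw [hexp]; exact ENNReal.ofReal_ne_top
  have h2 := ENNReal.hasSum_toReal hfin
  have h3 : (∑' o, (I.asniRR drawTime ε ℓ k o * ENNReal.ofReal (o.1 v)).toReal) = I.sni v := by
    rw [← ENNReal.tsum_toReal_eq (ENNReal.ne_top_of_tsum_ne_top hfin)]
    change ((I.asniRR drawTime ε ℓ k).expect fun o => ENNReal.ofReal (o.1 v)).toReal = _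
    rw [hexp, ENNReal.toReal_ofReal (zero_le_one.trans (I.one_le_sni v))]
  rw [h3] at h2
  convert h2 using 2 with o
  rw [ENNReal.toReal_mul]
  by_cases ho : I.asniRR drawTime ε ℓ k o = 0
  · simp [ho]
  · rw [ENNReal.toReal_ofReal (hnonneg o ((PMF.mem_support_iff _ _).2 ho))]

end TriggeringInstance

end

/-! ### Expected running time -/

noncomputable section

namespace TriggeringInstance

theorem finalSize_anti (n : ℕ) {ε ℓ a b : ℝ} (hε : 0 < ε) (hℓ : 0 < ℓ) (ha : 0 < a)
    (hab : a ≤ b) : finalSize n ε ℓ b ≤ finalSize n ε ℓ a := by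
  have := finalExponent_pos n hℓ
  unfold finalSize
  gcongr

variable {V : Type*} [Fintype V] [DecidableEq V] [Nonempty V]

/-- The steps of Phase 1 plus the expected number of steps of the Phase 2 that follows. -/
def totalCost (I : TriggeringInstance V) (drawTime : V → ℕ) (ε ℓ : ℝ) (q : ℝ × ℕ) : ℝ≥0∞ :=
  q.2 + finalSize (Fintype.card V) ε ℓ q.1 * I.rrCost drawTime

theorem expect_asniRR_steps (I : TriggeringInstance V) (drawTime : V → ℕ) (ε ℓ : ℝ) (k : ℕ) :
    ((I.asniRR drawTime ε ℓ k).expect fun o => (o.2 : ℝ≥0∞))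
      = (I.phaseOne drawTime ε ℓ k (Nat.log 2 (Fintype.card V) - 1) 1 fun _ => 0).expect
        (I.totalCost drawTime ε ℓ) := by
  rw [asniRR, PMF.expect_bind]
  refine congrArg (PMF.expect _) (funext fun q => ?_)
  simp only [PMF.expect_bind, PMF.expect_pure, Nat.cast_add, PMF.expect_add, PMF.expect_const,
    expect_sampleLoop_steps, totalCost]

/-- The stopping condition of round `i` of Phase 1 is not met. -/
def NotStopped (ε ℓ : ℝ) (k i : ℕ) : Set (V → ℕ) :=
  {est | ¬ (1 + √2 * ε) * ((Fintype.card V : ℝ) / 2 ^ i)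
    ≤ (Fintype.card V : ℝ) * (kthLargest est k : ℕ) / (roundSize (Fintype.card V) ε ℓ i : ℝ)}

/-- One round of Phase 1: a bound of the cost of the continuation, when the round stops and when
it does not, gives a bound of the total cost. -/
theorem expect_phaseOne_succ_le (I : TriggeringInstance V) (drawTime : V → ℕ) {ε ℓ : ℝ}
    (hε : 0 < ε) (hℓ : 0 < ℓ) (k r i : ℕ) (est : V → ℕ) (g : (V → ℕ) → ℝ≥0∞)
    (hmet : ∀ e ∉ NotStopped ε ℓ k (i + 1),
      finalSize (Fintype.card V) ε ℓ ((Fintype.card V : ℝ) / 2 ^ (i + 1)) * I.rrCost drawTime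
        ≤ g e)
    (hcont : ∀ e ∈ NotStopped ε ℓ k (i + 1),
      (I.phaseOne drawTime ε ℓ k r (i + 1 + 1) e).expect (I.totalCost drawTime ε ℓ) ≤ g e) :
    (I.phaseOne drawTime ε ℓ k (r + 1) (i + 1) est).expect (I.totalCost drawTime ε ℓ)
      ≤ ((roundSize (Fintype.card V) ε ℓ (i + 1) - roundSize (Fintype.card V) ε ℓ i : ℕ) : ℝ≥0∞)
          * I.rrCost drawTime
        + (I.sampleLoop drawTime (roundSize (Fintype.card V) ε ℓ (i + 1)
          - roundSize (Fintype.card V) ε ℓ i) est).expect fun o => g o.1 := by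
  -- The cost of a batch and its estimates are dependent, but only linearity of expectation is used.
  rw [phaseOne, PMF.expect_bind, add_tsub_cancel_right, ← expect_sampleLoop_steps I drawTime _ est,
    ← PMF.expect_add]
  refine PMF.expect_mono _ fun o => ?_
  have hb : 0 < 1 + √2 * ε := by positivity
  have hn0 : (0 : ℝ) < Fintype.card V := by exact_mod_cast Fintype.card_pos
  dsimp only
  split_ifs with h
  · rw [PMF.expect_pure, totalCost]
    refine add_le_add_right (le_trans ?_ (hmet o.1 (not_not.2 h))) _
    refine mul_le_mul_left ?_ _
    rw [Nat.cast_le]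
    -- Stopping returns a lower bound that is at least the threshold of the round.
    refine finalSize_anti _ hε hℓ (by positivity) ?_
    rw [← div_div, le_div_iff₀ hb]
    linarith
  · rw [PMF.expect_bind]
    simp only [PMF.expect_pure, totalCost, Nat.cast_add, add_assoc]
    rw [PMF.expect_add, PMF.expect_const]
    exact add_le_add_right (hcont o.1 h) _

/-- The worst case: all rounds are sampled and Phase 2 runs with the smallest possible bound `LB =
1`. -/
theorem expect_phaseOne_le (I : TriggeringInstance V) (drawTime : V → ℕ) {ε ℓ : ℝ}
    (hε : 0 < ε) (hℓ : 0 < ℓ) (k r i : ℕ) (est : V → ℕ)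
    (hr : i + r ≤ Nat.log 2 (Fintype.card V)) :
    (I.phaseOne drawTime ε ℓ k r (i + 1) est).expect (I.totalCost drawTime ε ℓ)
      ≤ ((roundSize (Fintype.card V) ε ℓ (i + r) - roundSize (Fintype.card V) ε ℓ i
          + finalSize (Fintype.card V) ε ℓ 1 : ℕ) : ℝ≥0∞) * I.rrCost drawTime := by
  induction r generalizing i est with
  | zero => simp [phaseOne, PMF.expect_pure, totalCost]
  | succ r ih =>
    set θ := roundSize (Fintype.card V) ε ℓ
    set F := finalSize (Fintype.card V) ε ℓ
    refine (I.expect_phaseOne_succ_le drawTime hε hℓ k r i est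
      (fun _ => ((θ (i + 1 + r) - θ (i + 1) + F 1 : ℕ) : ℝ≥0∞) * I.rrCost drawTime)
      (fun e _ => ?_) fun e _ => ih (i + 1) e (by omega)).trans ?_
    · refine mul_le_mul_left ?_ _
      rw [Nat.cast_le]
      refine le_trans ?_ (Nat.le_add_left _ _)
      exact finalSize_anti _ hε hℓ one_pos
        (one_le_card_div_two_pow Fintype.card_ne_zero (by omega))
    · have h2 : θ i ≤ θ (i + 1) := roundSize_mono _ _ _ (by omega)
      have h3 : θ (i + 1) ≤ θ (i + 1 + r) := roundSize_mono _ _ _ (by omega)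
      rw [PMF.expect_const, ← add_mul, ← Nat.cast_add, show i + (r + 1) = i + 1 + r by ring]
      refine mul_le_mul_left ?_ _
      rw [Nat.cast_le]
      change θ (i + 1) - θ i + (θ (i + 1 + r) - θ (i + 1) + F 1) ≤ θ (i + 1 + r) - θ i + F 1
      omega

/-- If the stopping condition is likely to hold in some round, then the expected total cost is
governed by the sample sizes of that round. -/
theorem expect_phaseOne_le_of_round (I : TriggeringInstance V) (drawTime : V → ℕ) {ε ℓ : ℝ}
    (hε : 0 < ε) (hℓ : 0 < ℓ) (k r i j : ℕ) (est : V → ℕ)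
    (hr : i + r ≤ Nat.log 2 (Fintype.card V)) (hj : j < r) :
    (I.phaseOne drawTime ε ℓ k r (i + 1) est).expect (I.totalCost drawTime ε ℓ)
      ≤ ((roundSize (Fintype.card V) ε ℓ (i + 1 + j) - roundSize (Fintype.card V) ε ℓ i
          + finalSize (Fintype.card V) ε ℓ ((Fintype.card V : ℝ) / 2 ^ (i + 1 + j)) : ℕ) : ℝ≥0∞)
          * I.rrCost drawTime
        + (I.sampleLoop drawTime (roundSize (Fintype.card V) ε ℓ (i + 1 + j)
            - roundSize (Fintype.card V) ε ℓ i) est).prob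
              {o | o.1 ∈ NotStopped ε ℓ k (i + 1 + j)}
          * (((roundSize (Fintype.card V) ε ℓ (i + r) + finalSize (Fintype.card V) ε ℓ 1 : ℕ)
            : ℝ≥0∞) * I.rrCost drawTime) := by
  induction r generalizing i j est with
  | zero => omega
  | succ r ih =>
    have hn0 : (0 : ℝ) < Fintype.card V := by exact_mod_cast Fintype.card_pos
    set n := Fintype.card V
    set θ := roundSize n ε ℓ
    set F := finalSize n ε ℓ
    set K := ((θ (i + (r + 1)) + F 1 : ℕ) : ℝ≥0∞) * I.rrCost drawTime with hK
    rw [show i + (r + 1) = i + 1 + r by ring] at hK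
    have h2 : θ i ≤ θ (i + 1) := roundSize_mono _ _ _ (by omega)
    cases j with
    | zero =>
      refine (I.expect_phaseOne_succ_le drawTime hε hℓ k r i est
        (fun e => F ((n : ℝ) / 2 ^ (i + 1)) * I.rrCost drawTime
          + (NotStopped ε ℓ k (i + 1)).indicator 1 e * K)
        (fun e _ => le_self_add) fun e he => ?_).trans ?_
      -- When the chosen round does not stop, the worst-case cost is charged.
      · refine (I.expect_phaseOne_le drawTime hε hℓ k r (i + 1) e
          (show i + 1 + r ≤ Nat.log 2 n by omega)).trans ?_
        rw [Set.indicator_of_mem he, Pi.one_apply, one_mul, hK]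
        refine le_add_left ?_
        refine mul_le_mul_left ?_ _
        rw [Nat.cast_le]
        exact Nat.add_le_add_right (Nat.sub_le _ _) _
      · rw [PMF.expect_add, PMF.expect_const, PMF.expect_mul_const, ← add_assoc, ← add_mul,
          ← Nat.cast_add]
        rfl
    | succ j =>
      have h3 : θ (i + 1) ≤ θ (i + 1 + (j + 1)) := roundSize_mono _ _ _ (by omega)
      have hidx : i + 1 + 1 + j = i + 1 + (j + 1) := by ring
      refine (I.expect_phaseOne_succ_le drawTime hε hℓ k r i est
        (fun e => ((θ (i + 1 + (j + 1)) - θ (i + 1) + F ((n : ℝ) / 2 ^ (i + 1 + (j + 1))) : ℕ)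
            : ℝ≥0∞) * I.rrCost drawTime
          + (I.sampleLoop drawTime (θ (i + 1 + (j + 1)) - θ (i + 1)) e).prob
              {o | o.1 ∈ NotStopped ε ℓ k (i + 1 + (j + 1))} * K)
        (fun e _ => ?_) fun e _ => ?_).trans ?_
      · refine le_add_right ?_
        refine mul_le_mul_left ?_ _
        rw [Nat.cast_le]
        refine le_trans ?_ (Nat.le_add_left _ _)
        -- An earlier stop has a larger threshold, hence a cheaper Phase 2.
        exact finalSize_anti _ hε hℓ (by positivity) (div_le_div_of_nonneg_left hn0.le
          (by positivity) (pow_le_pow_right₀ one_le_two (Nat.le_add_right _ _)))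
      · have := ih (i + 1) j e (by omega) (by omega)
        rwa [hidx, ← hK] at this
      · rw [PMF.expect_add, PMF.expect_const, PMF.expect_mul_const, prob_sampleLoop_add,
          show θ (i + 1) - θ i + (θ (i + 1 + (j + 1)) - θ (i + 1))
            = θ (i + 1 + (j + 1)) - θ i by omega, ← add_assoc, ← add_mul, ← Nat.cast_add,
          ← add_assoc, show θ (i + 1) - θ i + (θ (i + 1 + (j + 1)) - θ (i + 1))
            = θ (i + 1 + (j + 1)) - θ i by omega]

/-- The assumption on `ℓ` is this inequality in logarithmic form; it pays for a union bound over `k`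
nodes. -/
theorem natCast_le_rpow_mul_logb {n k : ℕ} (hn : 2 ≤ n) (hk : 1 ≤ k) {ℓ : ℝ}
    (h : (Real.logb 2 k - Real.logb 2 (Real.logb 2 n)) / Real.logb 2 n ≤ ℓ) :
    (k : ℝ) ≤ (n : ℝ) ^ ℓ * Real.logb 2 n := by
  have h0 : (0 : ℝ) < n := by positivity
  have hk0 : (0 : ℝ) < k := by positivity
  have h1 : 0 < Real.logb 2 n := one_pos.trans_le (one_le_logb_two hn)
  rw [div_le_iff₀ h1, sub_le_iff_le_add] at h
  rw [← Real.logb_le_logb one_lt_two hk0 (by positivity),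
    Real.logb_mul (by positivity) h1.ne', Real.logb_rpow_eq_mul_logb_of_pos h0]
  exact h

/-- A round whose threshold is well below `ψ⁽ᵏ⁾` stops, except with probability `1 / (2 n)`. -/
theorem prob_notStopped_le (I : TriggeringInstance V) (drawTime : V → ℕ) {ε ℓ : ℝ}
    (hε : 0 < ε) (hℓ : 0 < ℓ) {k : ℕ} (hk : 1 ≤ k) (hkn : k ≤ Fintype.card V)
    (hn : 2 ≤ Fintype.card V)
    (hkℓ : (k : ℝ) ≤ (Fintype.card V : ℝ) ^ ℓ * Real.logb 2 (Fintype.card V)) (i : ℕ)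
    (hi : (1 + √2 * ε) ^ 2 * ((Fintype.card V : ℝ) / 2 ^ (i + 1)) ≤ kthLargest I.sni k) :
    (I.sampleLoop drawTime (roundSize (Fintype.card V) ε ℓ (i + 1)) fun _ => 0).prob
        {o | o.1 ∈ NotStopped ε ℓ k (i + 1)}
      ≤ ENNReal.ofReal (1 / (2 * (Fintype.card V : ℝ))) := by
  set n := Fintype.card V with hndef
  have hn0 : (0 : ℝ) < n := by positivity
  set θ := roundSize n ε ℓ (i + 1) with hθ
  set e := √2 * ε
  have he : 0 < e := by positivity
  set x : ℝ := (n : ℝ) / 2 ^ (i + 1) with hx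
  have hx0 : 0 < x := by positivity
  set P := I.sampleLoop drawTime θ fun _ => 0
  have hA0 := roundExponent_pos hn hℓ
  have hA : roundExponent n ℓ ≤ e ^ 2 * θ * (x / n) / (2 + 2 / 3 * e) :=
    le_of_sampleSize hn0 he hx0 le_rfl
  have hθ0 : (0 : ℝ) < θ := by
    rcases (Nat.cast_nonneg (α := ℝ) θ).eq_or_lt with h | h
    · rw [← h] at hA
      simp only [mul_zero, zero_mul, zero_div] at hA
      linarith
    · exact h
  obtain ⟨⟨S, hS, hSψ⟩, _⟩ := kthLargest_spec I.sni hk hkn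
  -- Since `1 - d = 1 / (1 + e)`, a top node with a deviation below `d` still passes the threshold;
  -- since `d (1 + e) = e`, the tail exponent is at least the planned one.
  set d := e / (1 + e) with hd
  have hd0 : 0 < d := by positivity
  have hsub : {o : (V → ℕ) × ℕ | o.1 ∈ NotStopped ε ℓ k (i + 1)}
      ⊆ ⋃ v ∈ S, {o | o.1 v ≤ θ * (I.sni v / n - d * (I.sni v / n))} := by
    intro o ho
    have ho' : n * (kthLargest o.1 k : ℕ) / θ < (1 + e) * x := not_le.1 ho
    obtain ⟨v, hv, hvK⟩ := (kthLargest_spec o.1 hk hkn).2 S hS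
    refine Set.mem_iUnion₂.2 ⟨v, hv, ?_⟩
    have h2 : (o.1 v : ℝ) ≤ (kthLargest o.1 k : ℕ) := by exact_mod_cast hvK
    have h3 := hi.trans (hSψ v hv)
    rw [div_lt_iff₀ hθ0] at ho'
    change (o.1 v : ℝ) ≤ θ * (I.sni v / n - d * (I.sni v / n))
    have h4 : (1 + e) * x ≤ I.sni v / (1 + e) := by
      rw [le_div_iff₀ (by positivity)]
      linarith
    have h5 : (θ : ℝ) * (I.sni v / n - d * (I.sni v / n)) = θ * (I.sni v / (1 + e)) / n := by
      rw [hd]; field_simp; ring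
    rw [h5, le_div_iff₀ hn0]
    calc (o.1 v : ℝ) * n ≤ n * (kthLargest o.1 k : ℕ) := by rw [mul_comm]; gcongr
      _ ≤ (1 + e) * x * θ := ho'.le
      _ ≤ I.sni v / (1 + e) * θ := by gcongr
      _ = _ := mul_comm _ _
  refine (P.prob_mono hsub).trans ((P.prob_biUnion_le _ _).trans ?_)
  have hv : ∀ v ∈ S, P.prob {o | o.1 v ≤ θ * (I.sni v / n - d * (I.sni v / n))}
        ≤ ENNReal.ofReal (Real.exp (-roundExponent n ℓ)) := by
    intro v hv
    refine (I.sampleLoop_lower_tail drawTime θ v hd0 le_rfl).trans (ENNReal.ofReal_le_ofReal ?_)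
    rw [Real.exp_le_exp, neg_le_neg_iff]
    have h3 := hi.trans (hSψ v hv)
    calc roundExponent n ℓ ≤ e ^ 2 * θ * (x / n) / (2 + 2 / 3 * e) := hA
      _ ≤ e ^ 2 * θ * (x / n) / 2 := by gcongr; linarith
      _ = d ^ 2 * θ * ((1 + e) ^ 2 * x / n) / 2 := by rw [hd]; field_simp
      _ ≤ d ^ 2 * θ * (I.sni v / n) / 2 := by gcongr
  refine (Finset.sum_le_card_nsmul _ _ _ hv).trans ?_
  have h1 : 0 < Real.logb 2 n := one_pos.trans_le (one_le_logb_two hn)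
  have hpow : (0 : ℝ) < (n : ℝ) ^ ℓ := Real.rpow_pos_of_pos hn0 _
  rw [nsmul_eq_mul, exp_neg_roundExponent hn, hS, ← ENNReal.ofReal_natCast,
    ← ENNReal.ofReal_mul (Nat.cast_nonneg _)]
  refine ENNReal.ofReal_le_ofReal ?_
  rw [mul_one_div, div_le_div_iff₀ (by positivity) (by positivity)]
  nlinarith

/-- A common upper bound `1 + n A a / (ε² x)` of the sample sizes for the threshold `x`. -/
def sizeBound (n : ℕ) (ε ε₀ ℓ x : ℝ) : ℝ :=
  1 + (n : ℝ) * ((ℓ + 3) * Real.log n) * (2 + ε₀) / (ε ^ 2 * x)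

theorem sizeBound_scale (n : ℕ) {ε ε₀ ℓ x y s : ℝ} (hε : 0 < ε) (hε₀ : 0 < ε₀) (hℓ : 0 < ℓ)
    (hx : 0 < x) (hy : 0 < y) (hs : 1 ≤ s) (hyx : y ≤ s * x) :
    sizeBound n ε ε₀ ℓ x ≤ s * sizeBound n ε ε₀ ℓ y := by
  have h1 : 0 ≤ Real.log n := Real.log_natCast_nonneg n
  unfold sizeBound
  rw [mul_add s, mul_one]
  refine add_le_add hs ?_
  rw [mul_div_assoc', div_le_div_iff₀ (by positivity) (by positivity)]
  set Z := (n : ℝ) * ((ℓ + 3) * Real.log n) * (2 + ε₀)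
  have hZ : 0 ≤ Z := by positivity
  calc Z * (ε ^ 2 * y) ≤ Z * (ε ^ 2 * (s * x)) := by gcongr
    _ = _ := by ring

theorem finalSize_le_sizeBound {n : ℕ} (hn : 2 ≤ n) {ε ε₀ ℓ x : ℝ} (hε : 0 < ε) (hεε : ε ≤ ε₀)
    (hℓ : 0 < ℓ) (hx : 0 < x) : (finalSize n ε ℓ x : ℝ) ≤ sizeBound n ε ε₀ ℓ x := by
  have hA := finalExponent_pos n hℓ
  refine (Nat.ceil_lt_add_one (by positivity)).le.trans ?_
  rw [add_comm, sizeBound]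
  have h2 : Real.log 2 ≤ Real.log n := Real.log_le_log two_pos (by exact_mod_cast hn)
  have h4 : Real.log 4 = 2 * Real.log 2 := by
    rw [show (4 : ℝ) = 2 ^ 2 by norm_num, Real.log_pow]; norm_num
  gcongr
  · linarith
  · linarith

theorem roundSize_le_sizeBound {n : ℕ} (hn : 2 ≤ n) {ε ε₀ ℓ : ℝ} (hε : 0 < ε) (hεε : ε ≤ ε₀)
    (hℓ : 0 < ℓ) (i : ℕ) :
    (roundSize n ε ℓ (i + 1) : ℝ) ≤ sizeBound n ε ε₀ ℓ ((n : ℝ) / 2 ^ (i + 1)) := by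
  have hn0 : (0 : ℝ) < n := by positivity
  have hA := roundExponent_pos hn hℓ
  have hceil : (roundSize n ε ℓ (i + 1) : ℝ) < n * roundExponent n ℓ * (2 + 2 / 3 * (√2 * ε))
      / ((√2 * ε) ^ 2 * ((n : ℝ) / 2 ^ (i + 1))) + 1 := Nat.ceil_lt_add_one (by positivity)
  refine hceil.le.trans ?_
  have h2 : Real.log 2 ≤ Real.log n := Real.log_le_log two_pos (by exact_mod_cast hn)
  have h3 : Real.log (Real.logb 2 n) ≤ Real.log n := by
    refine Real.log_le_log (one_pos.trans_le (one_le_logb_two hn)) ?_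
    rw [Real.logb_le_iff_le_rpow one_lt_two hn0, Real.rpow_natCast]
    exact_mod_cast Nat.lt_two_pow_self.le
  have h4 : roundExponent n ℓ ≤ (ℓ + 3) * Real.log n := by
    unfold roundExponent
    linarith
  have h5 : √2 ≤ 3 / 2 := Real.sqrt_le_iff.2 (by norm_num)
  rw [add_comm, sizeBound, mul_pow, Real.sq_sqrt zero_le_two, mul_assoc 2, ← div_div]
  gcongr
  -- The factor `2` from `(√2 ε)²` leaves ample room for `√2` in the numerator.
  rw [div_le_iff₀ two_pos, mul_assoc]
  have h6 : 2 + 2 / 3 * (√2 * ε) ≤ (2 + ε₀) * 2 := by nlinarith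
  have h7 : 0 ≤ (ℓ + 3) * Real.log n := hA.le.trans h4
  calc (n : ℝ) * (roundExponent n ℓ * (2 + 2 / 3 * (√2 * ε)))
      ≤ n * ((ℓ + 3) * Real.log n * ((2 + ε₀) * 2)) := by gcongr
    _ = _ := by ring

/-- Either some round has a threshold close to `ψ / b²`, or `ψ` is bounded by a constant. -/
theorem exists_round_or_le {n : ℕ} (hn : 2 ≤ n) {b ψ : ℝ} (hb : 1 ≤ b) (hψ : ψ ≤ n) :
    (∃ j < Nat.log 2 n - 1, b ^ 2 * ((n : ℝ) / 2 ^ (j + 1)) ≤ ψ ∧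
      ψ ≤ 4 * b ^ 2 * ((n : ℝ) / 2 ^ (j + 1))) ∨ ψ ≤ 4 * b ^ 2 := by
  classical
  have hb2 : 1 ≤ b ^ 2 := one_le_pow₀ hb
  have hn0 : (0 : ℝ) < n := by positivity
  by_cases hex : ∃ j, j < Nat.log 2 n - 1 ∧ b ^ 2 * ((n : ℝ) / 2 ^ (j + 1)) ≤ ψ
  · left
    -- The first round with a small enough threshold: its predecessor has twice that threshold and
    -- fails. For the very first round, `ψ ≤ n` is used instead.
    refine ⟨Nat.find hex, (Nat.find_spec hex).1, (Nat.find_spec hex).2, ?_⟩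
    have hlt := (Nat.find_spec hex).1
    cases hj : Nat.find hex with
    | zero =>
      rw [zero_add, pow_one]
      nlinarith
    | succ i =>
      have hmin := Nat.find_min hex (m := i) (by omega)
      have h : ψ < b ^ 2 * ((n : ℝ) / 2 ^ (i + 1)) := by
        by_contra! hle
        exact hmin ⟨by omega, hle⟩
      have h2 : (n : ℝ) / 2 ^ (i + 1) = 2 * (n / 2 ^ (i + 1 + 1)) := by
        rw [pow_succ 2 (i + 1)]; field_simp
      have h3 : 0 < b ^ 2 * ((n : ℝ) / 2 ^ (i + 1 + 1)) := by positivity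
      rw [h2] at h
      linarith
  · right
    have hlog : n < 2 ^ (Nat.log 2 n + 1) := Nat.lt_pow_succ_log_self (by norm_num) n
    -- Without rounds `n ≤ 4`; otherwise the last threshold is at most `4` and still too large.
    rcases Nat.eq_zero_or_pos (Nat.log 2 n - 1) with h0 | h0
    · have h4 : n ≤ 4 := by
        have : (2 : ℕ) ^ (Nat.log 2 n + 1) ≤ 2 ^ 2 := Nat.pow_le_pow_right (by norm_num) (by omega)
        omega
      have h4' : (n : ℝ) ≤ 4 := by exact_mod_cast h4
      linarith
    · push Not at hex
      have h := hex (Nat.log 2 n - 1 - 1) (by omega)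
      rw [show Nat.log 2 n - 1 - 1 + 1 = Nat.log 2 n - 1 by omega] at h
      have h2 : (n : ℝ) / 2 ^ (Nat.log 2 n - 1) ≤ 4 := by
        rw [div_le_iff₀ (by positivity)]
        have : n < 4 * 2 ^ (Nat.log 2 n - 1) := by
          calc n < 2 ^ (Nat.log 2 n + 1) := hlog
            _ = 4 * 2 ^ (Nat.log 2 n - 1) := by
              rw [show Nat.log 2 n + 1 = (Nat.log 2 n - 1) + 2 by omega, pow_add]; ring
        exact_mod_cast this.le
      nlinarith

/-- The expected number of steps, as a multiple of the expected cost of one RR set. -/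
theorem expect_asniRR_steps_le (I : TriggeringInstance V) (drawTime : V → ℕ) {ε ε₀ ℓ : ℝ}
    (hε : 0 < ε) (hεε : ε ≤ ε₀) (hℓ : 0 < ℓ) {k : ℕ} (hk : 1 ≤ k) (hkn : k ≤ Fintype.card V)
    (hn : 2 ≤ Fintype.card V)
    (hkℓ : (k : ℝ) ≤ (Fintype.card V : ℝ) ^ ℓ * Real.logb 2 (Fintype.card V)) :
    ((I.asniRR drawTime ε ℓ k).expect fun o => (o.2 : ℝ≥0∞))
      ≤ ENNReal.ofReal ((8 * (1 + √2 * ε₀) ^ 2 + 1)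
          * sizeBound (Fintype.card V) ε ε₀ ℓ (kthLargest I.sni k)) * I.rrCost drawTime := by
  rw [expect_asniRR_steps]
  have hψ1 := I.one_le_kthLargest_sni hk hkn
  have hψn := I.kthLargest_sni_le_card hk hkn
  have hn0 : (0 : ℝ) < Fintype.card V := by positivity
  set n := Fintype.card V
  set ψ := kthLargest I.sni k
  set θ := roundSize n ε ℓ with hθdef
  set F := finalSize n ε ℓ with hFdef
  set H := sizeBound n ε ε₀ ℓ with hHdef
  set r := Nat.log 2 n - 1 with hr
  have hε₀ : 0 < ε₀ := hε.trans_le hεε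
  have hψ0 : 0 < ψ := zero_lt_one.trans_le hψ1
  have hlogn : 0 ≤ Real.log n := Real.log_natCast_nonneg n
  have hH0 : ∀ x, 0 < x → 0 ≤ H x := fun x hx => by
    rw [hHdef]; unfold sizeBound; positivity
  set b := 1 + √2 * ε with hb
  set B := 1 + √2 * ε₀ with hB
  have hb1 : 1 ≤ b := by rw [hb]; linarith [show 0 ≤ √2 * ε by positivity]
  have hbB : 4 * b ^ 2 ≤ 4 * B ^ 2 := by rw [hb, hB]; gcongr
  have hB1 : 1 ≤ 4 * B ^ 2 := by nlinarith
  have hF1 : (F 1 : ℝ) ≤ H 1 := finalSize_le_sizeBound hn hε hεε hℓ one_pos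
  have hθr : (θ r : ℝ) ≤ H 1 := by
    rcases Nat.eq_zero_or_pos r with h0 | h0
    · rw [h0, hθdef, show roundSize n ε ℓ 0 = 0 from rfl, Nat.cast_zero]
      exact hH0 1 one_pos
    · obtain ⟨s, hs⟩ : ∃ s, r = s + 1 := ⟨r - 1, by omega⟩
      rw [hs]
      refine (roundSize_le_sizeBound hn hε hεε hℓ s).trans ?_
      have h1 : (1 : ℝ) ≤ n / 2 ^ (s + 1) := one_le_card_div_two_pow (by omega) (by omega)
      have := sizeBound_scale n hε hε₀ hℓ (zero_lt_one.trans_le h1) one_pos le_rfl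
        (by rwa [one_mul])
      rwa [one_mul] at this
  rcases exists_round_or_le hn hb1 hψn with ⟨j, hj, hj1, hj2⟩ | hsmall
  · refine (I.expect_phaseOne_le_of_round drawTime hε hℓ k r 0 j _
      (show 0 + r ≤ Nat.log 2 n by omega) hj).trans ?_
    have hP := I.prob_notStopped_le drawTime hε hℓ hk hkn hn hkℓ j hj1
    rw [show 0 + 1 + j = j + 1 by ring, show roundSize n ε ℓ 0 = 0 from rfl, Nat.sub_zero, zero_add]
    set x := (n : ℝ) / 2 ^ (j + 1)
    have hx0 : 0 < x := by positivity
    refine (add_le_add_right (mul_le_mul_left hP _) _).trans ?_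
    rw [← mul_assoc, ← add_mul]
    refine mul_le_mul_left ?_ _
    rw [← ENNReal.ofReal_natCast, ← ENNReal.ofReal_natCast,
      ← ENNReal.ofReal_mul (by positivity), ← ENNReal.ofReal_add (by positivity) (by positivity)]
    refine ENNReal.ofReal_le_ofReal ?_
    have h1 : (θ (j + 1) : ℝ) ≤ H x := roundSize_le_sizeBound hn hε hεε hℓ j
    have h2 : (F x : ℝ) ≤ H x := finalSize_le_sizeBound hn hε hεε hℓ hx0
    have h3 : H x ≤ 4 * B ^ 2 * H ψ := by
      refine sizeBound_scale n hε hε₀ hℓ hx0 hψ0 hB1 (hj2.trans ?_)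
      gcongr
    have h4 : H n ≤ H ψ := by
      have := sizeBound_scale n hε hε₀ hℓ hn0 hψ0 le_rfl (by rwa [one_mul])
      rwa [one_mul] at this
    -- Since `H x - 1` is proportional to `1 / x`, multiplying `H 1` by `1 / n` gives `H n` up to
    -- the rounding term.
    have h5 : 1 / (2 * (n : ℝ)) * (2 * H 1) ≤ H n := by
      have h6 : 1 / (n : ℝ) ≤ 1 := by
        rw [div_le_one hn0]
        exact_mod_cast (by omega : 1 ≤ n)
      have h7 : 1 / (2 * (n : ℝ)) * (2 * H 1) = 1 / n + (H n - 1) := by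
        simp only [hHdef, sizeBound]
        field_simp
        ring
      linarith
    have h8 : 1 / (2 * (n : ℝ)) * ((θ r : ℝ) + F 1) ≤ 1 / (2 * (n : ℝ)) * (2 * H 1) := by
      gcongr
      linarith
    push_cast
    -- The chosen round and its Phase 2 contribute `4 B² H ψ` each, the failure to stop `H ψ`.
    linarith
  · refine (I.expect_phaseOne_le drawTime hε hℓ k r 0 _
      (show 0 + r ≤ Nat.log 2 n by omega)).trans ?_
    rw [show roundSize n ε ℓ 0 = 0 from rfl, Nat.sub_zero, zero_add]
    refine mul_le_mul_left ?_ _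
    rw [← ENNReal.ofReal_natCast]
    refine ENNReal.ofReal_le_ofReal ?_
    have h3 : H 1 ≤ 4 * B ^ 2 * H ψ :=
      sizeBound_scale n hε hε₀ hℓ one_pos hψ0 hB1 (by linarith)
    have h9 := hH0 ψ hψ0
    push_cast
    linarith

/-- The rounding term `1` is absorbed at the price `ε₀²`, because `ψ ≤ n`, `ε ≤ ε₀` and `(ℓ + 3) ln
n ≥ 1`; the `3` is absorbed into `ℓ` by means of `ℓ ≥ ℓ₀`. -/
theorem sizeBound_le {n : ℕ} (hn : 2 ≤ n) {ε ε₀ ℓ ℓ₀ ψ : ℝ} (hε : 0 < ε) (hεε : ε ≤ ε₀)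
    (hℓ₀ : 0 < ℓ₀) (hℓℓ : ℓ₀ ≤ ℓ) (hψ0 : 0 < ψ) (hψn : ψ ≤ n) :
    sizeBound n ε ε₀ ℓ ψ
      ≤ (ε₀ ^ 2 + (2 + ε₀)) * (1 + 3 / ℓ₀) * (n * (ℓ * Real.log n) / (ψ * ε ^ 2)) := by
  have hε₀ : 0 < ε₀ := hε.trans_le hεε
  have hℓ : 0 < ℓ := hℓ₀.trans_le hℓℓ
  have h2 : Real.log 2 ≤ Real.log n := Real.log_le_log two_pos (by exact_mod_cast hn)
  have hlog : 0.69 < Real.log n := by linarith [Real.log_two_gt_d9]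
  have hA : ℓ + 3 ≤ (1 + 3 / ℓ₀) * ℓ := by
    have : 3 ≤ 3 / ℓ₀ * ℓ := by
      rw [div_mul_eq_mul_div, le_div_iff₀ hℓ₀]; linarith
    linarith
  set A := (ℓ + 3) * Real.log n with hAdef
  have hA1 : 1 ≤ A := by nlinarith
  have h1 : 1 ≤ ε₀ ^ 2 * (n * A / (ψ * ε ^ 2)) := by
    rw [mul_div_assoc', le_div_iff₀ (by positivity), one_mul]
    calc ψ * ε ^ 2 ≤ n * ε₀ ^ 2 := by gcongr
      _ = ε₀ ^ 2 * (n * 1) := by ring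
      _ ≤ ε₀ ^ 2 * (n * A) := by gcongr
  calc sizeBound n ε ε₀ ℓ ψ = 1 + (2 + ε₀) * (n * A / (ψ * ε ^ 2)) := by
        rw [sizeBound, mul_comm ψ]; ring
    _ ≤ (ε₀ ^ 2 + (2 + ε₀)) * (n * A / (ψ * ε ^ 2)) := by linarith
    _ ≤ (ε₀ ^ 2 + (2 + ε₀)) * (n * ((1 + 3 / ℓ₀) * ℓ * Real.log n) / (ψ * ε ^ 2)) := by
        rw [hAdef]; gcongr
    _ = _ := by ring

theorem asniRR_expected_time (c : ℕ) {ℓ₀ ε₀ : ℝ} (hℓ₀ : 0 < ℓ₀)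
    (I : TriggeringInstance V) {drawTime : V → ℕ} {ε ℓ : ℝ} {k : ℕ}
    (hn : 2 ≤ Fintype.card V) (hE : I.edges.Nonempty)
    (hc : ∀ v, drawTime v ≤ c * I.inDegree v) (hε : 0 < ε) (hεε : ε ≤ ε₀) (hℓℓ : ℓ₀ ≤ ℓ)
    (hk : 1 ≤ k) (hkn : k ≤ Fintype.card V)
    (hkℓ : (Real.logb 2 k - Real.logb 2 (Real.logb 2 (Fintype.card V)))
      / Real.logb 2 (Fintype.card V) ≤ ℓ) :
    ∑' o, I.asniRR drawTime ε ℓ k o * (o.2 : ℝ≥0∞) ≤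
      ENNReal.ofReal (((c + 3) * (8 * (1 + √2 * ε₀) ^ 2 + 1) * (ε₀ ^ 2 + (2 + ε₀))
          * (1 + 3 / ℓ₀)) * (ℓ * ((I.edges.card : ℝ) + (Fintype.card V : ℝ))
        * Real.log (Fintype.card V) * I.meanSpread / (kthLargest I.sni k * ε ^ 2))) := by
  have hℓ : 0 < ℓ := hℓ₀.trans_le hℓℓ
  have hε₀ : 0 < ε₀ := hε.trans_le hεε
  have hψ1 := I.one_le_kthLargest_sni hk hkn
  have hψ0 : 0 < kthLargest I.sni k := zero_lt_one.trans_le hψ1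
  have hn0 : (0 : ℝ) < Fintype.card V := by positivity
  have hM := I.one_le_meanSpread hE
  have hM0 : 0 < I.meanSpread := zero_lt_one.trans_le hM
  have h1 := I.expect_asniRR_steps_le drawTime hε hεε hℓ hk hkn hn
    (natCast_le_rpow_mul_logb hn hk hkℓ)
  have h2 := sizeBound_le hn hε hεε hℓ₀ hℓℓ hψ0 (I.kthLargest_sni_le_card hk hkn)
  have hlogn : 0 ≤ Real.log (Fintype.card V) := Real.log_natCast_nonneg _
  have hH0 : 0 ≤ sizeBound (Fintype.card V) ε ε₀ ℓ (kthLargest I.sni k) := by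
    unfold sizeBound; positivity
  refine (h1.trans (mul_le_mul_right (I.rrCost_le hc hE) _)).trans ?_
  rw [← ENNReal.ofReal_mul (by positivity)]
  refine ENNReal.ofReal_le_ofReal ?_
  calc _ ≤ (8 * (1 + √2 * ε₀) ^ 2 + 1) * ((ε₀ ^ 2 + (2 + ε₀)) * (1 + 3 / ℓ₀)
          * (Fintype.card V * (ℓ * Real.log (Fintype.card V)) / (kthLargest I.sni k * ε ^ 2)))
        * ((c + 3) * ((I.edges.card + Fintype.card V) * I.meanSpread / Fintype.card V)) := by
        gcongr
    _ = _ := by field_simp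

end TriggeringInstance

end

theorem theorem4 :
    -- unbiasedness and robustness
    (∀ (V : Type*) [Fintype V] [DecidableEq V] [Nonempty V] (I : TriggeringInstance V)
        (drawTime : V → ℕ) (ε ℓ : ℝ) (k : ℕ),
      0 < ε → 0 < ℓ → 1 ≤ k → k ≤ Fintype.card V →
        (∀ v, HasSum (fun o => (I.asniRR drawTime ε ℓ k o).toReal * o.1 v) (I.sni v)) ∧
        ENNReal.ofReal (1 - 1 / (Fintype.card V : ℝ) ^ ℓ) ≤
          (I.asniRR drawTime ε ℓ k).toOuterMeasure {o | I.Robust ε k o.1}) ∧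
    -- expected running time
    (∀ (c : ℕ) (ℓ₀ ε₀ : ℝ), 0 < ℓ₀ → 0 < ε₀ → ∃ C : ℝ, 0 < C ∧
      ∀ (V : Type*) [Fintype V] [DecidableEq V] [Nonempty V] (I : TriggeringInstance V)
        (drawTime : V → ℕ) (ε ℓ : ℝ) (k : ℕ),
      2 ≤ Fintype.card V → I.edges.Nonempty →
      (∀ v, drawTime v ≤ c * I.inDegree v) →
      0 < ε → ε ≤ ε₀ → ℓ₀ ≤ ℓ → 1 ≤ k → k ≤ Fintype.card V →
      (Real.logb 2 k - Real.logb 2 (Real.logb 2 (Fintype.card V)))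
          / Real.logb 2 (Fintype.card V) ≤ ℓ →
        ∑' o, I.asniRR drawTime ε ℓ k o * (o.2 : ℝ≥0∞) ≤
          ENNReal.ofReal (C * (ℓ * ((I.edges.card : ℝ) + (Fintype.card V : ℝ))
            * Real.log (Fintype.card V) * I.meanSpread
              / (kthLargest I.sni k * ε ^ 2)))) := by
  refine ⟨fun V _ _ _ I drawTime ε ℓ k hε hℓ hk hkn =>
    ⟨fun v => I.asniRR_unbiased drawTime hε hℓ k v, I.asniRR_robust drawTime hε hℓ hk hkn⟩, ?_⟩
  intro c ℓ₀ ε₀ hℓ₀ hε₀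
  refine ⟨(c + 3) * (8 * (1 + √2 * ε₀) ^ 2 + 1) * (ε₀ ^ 2 + (2 + ε₀)) * (1 + 3 / ℓ₀),
    by positivity, ?_⟩
  intro V _ _ _ I drawTime ε ℓ k hn hE hc hε hεε hℓℓ hk hkn hkℓ
  exact I.asniRR_expected_time c hℓ₀ hn hE hc hε hεε hℓℓ hk hkn hkℓ
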